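/- Let $q=3^f$ with $f\ge 1$, fix a nontrivial homomorphism $\phi:(\mathbb F_q,+)\to\mathbb C^\times$ and put $\phi_a(t)=\phi(at)$. Let $UE_6$ be the Sylow $3$-subgroup of the (universal) Chevalley group $E_6(q)$ generated by the root subgroups $X_\alpha=\{x_\alpha(t):t\in\mathbb F_q\}$ of all positive roots $\alpha$, and let $T_0$ be the maximal split torus normalizing all $X_\alpha$; it acts on characters of $UE_6$ by ${}^t\chi(u)=\chi(t^{-1}ut)$. Let $$\mathcal F_6=\{\chi\in \mathrm{Irr}(UE_6): \text{for every positive root }\alpha\text{ of height }4\text{ there is }a\in\mathbb F_q^\times\text{ with }\chi|_{X_\alpha}=\chi(1)\phi_a\}.$$ *Notation.* Number the simple roots so that the Dynkin diagram is $\alpha_1-\alpha_3-\alpha_4-\alpha_5-\alpha_6$ with $\alpha_2$ joined to $\alpha_4$, and write $c_1c_2\cdots c_6$ for $\sum_i c_i\alpha_i$. The remaining roots of height at most $4$ are $\alpha_7=101000$, $\alpha_8=010100$, $\alpha_9=001100$, $\alpha_{10}=000110$, $\alpha_{11}=000011$, $\alpha_{12}=101100$, $\alpha_{13}=011100$, $\alpha_{14}=010110$,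 $\alpha_{15}=001110$, $\alpha_{16}=000111$, $\alpha_{17}=111100$, $\alpha_{18}=101110$, $\alpha_{19}=011110$, $\alpha_{20}=010111$, $\alpha_{21}=001111$. The root elements are normalized by $[x_\alpha(t),x_\beta(u)]=x_{\alpha+\beta}(\varepsilon(\alpha,\beta)tu)$ if $\alpha+\beta$ is a root (and $=1$ otherwise), where $\varepsilon$ is the $\{\pm1\}$-valued bimultiplicative function on the root lattice with $\varepsilon(\alpha_i,\alpha_j)=-1$ exactly if $i=j$, or if $i>j$ and $\alpha_i,\alpha_j$ are joined. Let $K_5$ be the normal subgroup of $UE_6$ generated by the $X_\alpha$ with $\alpha$ of height greater than $4$, let $U=UE_6/K_5$, and let $X_i=\{x_i(t)\}$ be the image of $X_{\alpha_i}$ in $U$. Characters of $U$ are regarded as characters of $UE_6$ by inflation. Let $H=\prod_{i\in\{8,9,10,12,\dots,21\}}X_i$. For $b=(b_8,b_9,b_{10},b_{12},\dots,b_{16})\in\mathbb F_q^8$ let $\lambda_b$ be the linear character of $H$ with $\lambda_b|_{X_i}=\phi_{b_i}$ for $i\le 16$ and $\lambda_b|_{X_i}=\phi$ for $17\le i\le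 21$. Put $$B_3(b)=b_{12}-b_{13}-b_{14}+b_{15}+b_{16},\qquad B_2(b)=b_{10}+b_9-b_8,$$ $$s_2(t)=x_2(t)x_1(t)x_3(-t)x_5(t)x_6(-t)x_7(2t^2)x_{11}(2t^2).$$ *The characters.* * For $B_3\in\mathbb F_q^\times$ fix any $b=b(B_3)$ with $B_3(b)=B_3$. For $b_4\in\mathbb F_q$, $\chi_{q^7}^{b_4,B_3}$ is the character induced to $U$ from the extension of $\lambda_b$ to $HX_4$ whose restriction to $X_4$ is $\phi_{b_4}$. * For $B_2\in\mathbb F_q\setminus\{c^2:c\in\mathbb F_q^\times\}$, $\chi_{q^7}^{B_2}$ is the common character induced to $U$ from every extension to $HX_4$ of every $\lambda_b$ with $b_{12}=\dots=b_{16}=0$ and $B_2(b)=B_2$. * For $B_2=c^2$ with $c\in\mathbb F_q^\times$ let $c_\phi\in\mathbb F_q^\times$ (unique up to sign) be such that $c_\phi\{t^3-c^2t:t\in\mathbb F_q\}=\ker\phi$, let $F_2=\{1,s_2(\pm c)\}$, $F_4=\{1,x_4(\pm c_\phi)\}$, and fix any $a_2,a_4\in\mathbb F_q$ (depending on $B_2$)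 with $\phi(a_2c)\ne1$, $\phi(a_4c_\phi)\neq 1$. For $b_2,b_4\in\mathbb F_3$, $\chi_{q^7/3}^{b_2,b_4,B_2}$ is the common character induced to $U$ from every linear character $\lambda_1$ of $HX_4F_2$ that extends some $\lambda_b$ with $b_{12}=\dots=b_{16}=0$ and $B_2(b)=B_2$, and satisfies $\lambda_1(s_2(t))=\phi(b_2a_2t)$ on $F_2$ and $\lambda_1(x_4(t))=\phi(b_4a_4t)$ on $F_4$. **Theorem.** Let $\chi\in\mathcal F_6$. (a) If $\chi(1)=q^7$, then there is $t\in T_0$ such that ${}^t\chi=\chi_{q^7}^{b_4,B_3}$ for some $b_4\in\mathbb F_q$, $B_3\in\mathbb F_q^\times$, or ${}^t\chi=\chi_{q^7}^{B_2}$ for some $B_2\in\mathbb F_q\setminus\{c^2:c\in\mathbb F_q^\times\}$. (b) If $\chi(1)=q^7/3$, then there is $t\in T_0$ such that ${}^t\chi=\chi_{q^7/3}^{b_2,b_4,B_2}$ for some $b_2,b_4\in\mathbb F_3$ and some $B_2\in\{c^2:c\in\mathbb F_q^\times\}$. -/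

import Mathlib

namespace E6Sylow

/-! ### The root system of type `E₆` and its root lattice

Elements of the root lattice are written in the basis of simple roots `α₁, …, α₆` (Bourbaki
numbering; the coordinate `i : Fin 6` belongs to `α_{i+1}`). -/

/-- The root lattice. -/
abbrev Lat : Type := Fin 6 → ℤ

/-- The invariant bilinear form, with `(α, α) = 2` for every root `α`. -/
def ip (a b : Lat) : ℤ := ∑ i, ∑ j, a i * CartanMatrix.E₆ i j * b j

/-- The roots are the vectors of norm `2` of the root lattice. -/
def IsRoot (a : Lat) : Prop := ip a a = 2

instance (a : Lat) : Decidable (IsRoot a) := inferInstanceAs (Decidable (_ = _))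

/-- The positive roots. -/
def IsPosRoot (a : Lat) : Prop := IsRoot a ∧ ∀ i, 0 ≤ a i

instance (a : Lat) : Decidable (IsPosRoot a) := inferInstanceAs (Decidable (_ ∧ _))

/-- The height of a root. -/
def ht (a : Lat) : ℤ := ∑ i, a i

/-- The bilinear form whose parity gives the signs of the structure constants. It satisfies
`signForm a b + signForm b a ≡ (a, b)` modulo `2` and `signForm a a = (a, a) / 2`. -/
def signForm (a b : Lat) : ℤ :=
  ∑ i, a i * b i + ∑ i, ∑ j, if j < i then a i * CartanMatrix.E₆ i j * b j else 0

/-- The structure constants: `[e_a, e_b] = sgn a b • e_{a+b}` whenever `a`, `b`, `a + b` are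
roots. For simple roots `α_i`, `α_j` that are joined in the Dynkin diagram, `sgn α_i α_j` is `1` if
`i < j` and `-1` if `i > j`. -/
def sgn (a b : Lat) : ℤ := ((signForm a b).negOnePow : ℤˣ)

/-! ### The minuscule representation and root elements -/

/-- The `27` weights of the minuscule representation with highest weight `ω₁`. A weight
`ω₁ - ∑ nᵢ αᵢ` is given by the numbers `nᵢ`, all of which are at most `4`; the weights
are the vectors of `ω₁ + Lat` with the same norm as `ω₁`. -/
abbrev Wt : Type :=
  {n : Fin 6 → Fin 5 // ip (fun i => ((n i : ℕ) : ℤ)) (fun i => ((n i : ℕ) : ℤ)) = 2 * ((n 0 : ℕ) : ℤ)}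

/-- The difference between a weight and the highest weight, an element of the root lattice. -/
def Wt.diff (w : Wt) : Lat := fun i => -((w.1 i : ℕ) : ℤ)

/-- The integer `⟨w, α_i^∨⟩` for a weight `w`. -/
def Wt.pairing (w : Wt) (i : Fin 6) : ℤ :=
  (∑ j, w.diff j * CartanMatrix.E₆ j i) + if i = 0 then 1 else 0

variable (F : Type*) [Field F]

/-- The root vector `e_a` in the minuscule representation: it maps the basis vector of weight `v`
to `sgn a v` times the basis vector of weight `v + a`, or to zero if `v + a` is not a weight. -/
def rootVec (a : Lat) : Matrix Wt Wt F :=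
  Matrix.of fun w v => if w.diff = v.diff + a then ((sgn a v.diff : ℤ) : F) else 0

theorem Wt.ip_diff (w : Wt) : ip w.diff w.diff = -2 * w.diff 0 := by
  have h := w.2
  have e : ip w.diff w.diff =
      ip (fun i => ((w.1 i : ℕ) : ℤ)) (fun i => ((w.1 i : ℕ) : ℤ)) := by
    simp [ip, Wt.diff]
  rw [e, h, Wt.diff]
  ring

theorem ip_add_add (a b : Lat) : ip (a + b) (a + b) = ip a a + ip a b + ip b a + ip b b := by
  simp only [ip, Pi.add_apply, ← Finset.sum_add_distrib]
  refine Finset.sum_congr rfl fun i _ => Finset.sum_congr rfl fun j _ => ?_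
  ring

theorem ip_two (v a : Lat) :
    ip (v + a + a) (v + a + a) = 2 * ip (v + a) (v + a) - ip v v + 2 * ip a a := by
  have h1 := ip_add_add (v + a) a
  have h2 := ip_add_add v a
  have h3 : ip (v + a) a = ip v a + ip a a := by
    simp only [ip, Pi.add_apply, ← Finset.sum_add_distrib]
    refine Finset.sum_congr rfl fun i _ => Finset.sum_congr rfl fun j _ => ?_
    ring
  have h4 : ip a (v + a) = ip a v + ip a a := by
    simp only [ip, Pi.add_apply, ← Finset.sum_add_distrib]
    refine Finset.sum_congr rfl fun i _ => Finset.sum_congr rfl fun j _ => ?_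
    ring
  linarith

theorem rootVec_sq (a : Lat) (ha : IsRoot a) : rootVec F a * rootVec F a = 0 := by
  ext w v
  rw [Matrix.mul_apply]
  refine Finset.sum_eq_zero fun u _ => ?_
  simp only [rootVec, Matrix.of_apply]
  split_ifs with h1 h2
  · exfalso
    have hw := w.ip_diff
    have hu := u.ip_diff
    have hv := v.ip_diff
    rw [h1, h2, ip_two] at hw
    rw [h2] at hu
    have ha' : ip a a = 2 := ha
    simp only [Pi.add_apply] at hw hu
    linarith
  all_goals simp

/-- The root element `x_a(t) = exp(t e_a) = 1 + t e_a` (set to `1` if `a` is not a root). -/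
def rootElt (a : Lat) (t : F) : GL Wt F :=
  if h : IsRoot a then
    ⟨1 + t • rootVec F a, 1 - t • rootVec F a,
      by simp [add_mul, mul_sub, rootVec_sq F a h],
      by simp [sub_mul, mul_add, rootVec_sq F a h]⟩
  else 1

/-- The Sylow subgroup `UE₆`, generated by all positive root subgroups of the Chevalley group of
type `E₆` over `F`. -/
def UE : Subgroup (GL Wt F) :=
  Subgroup.closure {g | ∃ a, IsPosRoot a ∧ ∃ t, g = rootElt F a t}

variable {F}

/-- The root elements `x_a(t)`, `a` a positive root, as elements of `UE₆`. -/
def x (a : Lat) (t : F) : UE F :=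
  if h : IsPosRoot a then
    ⟨rootElt F a t, Subgroup.subset_closure ⟨a, h, t, rfl⟩⟩
  else 1

/-! ### The maximal split torus -/

/-- The element `∏ᵢ h_{αᵢ}(sᵢ)` of the torus, which acts on the vectors of weight `w` as the scalar
`∏ᵢ sᵢ ^ ⟨w, αᵢ^∨⟩`. -/
def torusHom : (Fin 6 → Fˣ) →* GL Wt F where
  toFun s :=
    ⟨Matrix.diagonal fun w : Wt => ((∏ i, s i ^ w.pairing i : Fˣ) : F),
      Matrix.diagonal fun w : Wt => ((∏ i, s i ^ w.pairing i : Fˣ)⁻¹ : Fˣ),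
      by rw [Matrix.diagonal_mul_diagonal]; simp only [Units.mul_inv, Matrix.diagonal_one],
      by rw [Matrix.diagonal_mul_diagonal]; simp only [Units.inv_mul, Matrix.diagonal_one]⟩
  map_one' := by
    ext1
    simp
  map_mul' s r := by
    ext1
    simp [Matrix.diagonal_mul_diagonal, mul_zpow, Finset.prod_mul_distrib]

variable (F) in
/-- The maximal split torus `T₀`. -/
def torus : Subgroup (GL Wt F) := torusHom.range

theorem pairing_sub (w v : Wt) (a : Lat) (h : w.diff = v.diff + a) (i : Fin 6) :
    w.pairing i = v.pairing i + ∑ j, a j * CartanMatrix.E₆ j i := by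
  simp only [Wt.pairing, h, Pi.add_apply, add_mul, Finset.sum_add_distrib]
  ring

theorem torus_conj_rootElt (s : Fin 6 → Fˣ) (a : Lat) (t : F) :
    torusHom s * rootElt F a t =
      rootElt F a (((∏ i, s i ^ (∑ j, a j * CartanMatrix.E₆ j i) : Fˣ) : F) * t) * torusHom s := by
  by_cases ha : IsRoot a
  · ext w v
    simp only [rootElt, ha, dite_true, torusHom, MonoidHom.coe_mk, OneHom.coe_mk, Units.val_mul,
      Matrix.diagonal_mul, Matrix.mul_diagonal, Matrix.add_apply, Matrix.smul_apply, rootVec,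
      Matrix.of_apply, smul_eq_mul]
    have hd : ∀ k : F, k * (1 : Matrix Wt Wt F) w v = (1 : Matrix Wt Wt F) w v * k :=
      fun k => mul_comm _ _
    by_cases hwv : w.diff = v.diff + a
    · have hne : w ≠ v := by
        rintro rfl
        have h0 : a = 0 := by simpa using hwv
        rw [h0] at ha
        simp [IsRoot, ip] at ha
      rw [if_pos hwv, Matrix.one_apply_ne hne]
      simp only [pairing_sub w v a hwv, zpow_add, Finset.prod_mul_distrib, Units.val_mul]
      ring
    · rw [if_neg hwv]
      by_cases hw : w = v
      · subst hw; simp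
      · simp [Matrix.one_apply_ne hw]
  · simp [rootElt, ha]

/-- The torus normalizes `UE₆`. -/
theorem torus_conj_mem {t : GL Wt F} (ht : t ∈ torus F) {u : GL Wt F} (hu : u ∈ UE F) :
    t * u * t⁻¹ ∈ UE F := by
  obtain ⟨s, rfl⟩ := ht
  induction hu using Subgroup.closure_induction with
  | mem y hy =>
    obtain ⟨a, ha, r, rfl⟩ := hy
    rw [torus_conj_rootElt, mul_inv_cancel_right]
    exact Subgroup.subset_closure ⟨a, ha, _, rfl⟩
  | one => simp
  | mul y z _ _ hy hz =>
    have : torusHom s * (y * z) * (torusHom s)⁻¹ =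
      (torusHom s * y * (torusHom s)⁻¹) * (torusHom s * z * (torusHom s)⁻¹) := by group
    rw [this]
    exact (UE F).mul_mem hy hz
  | inv y _ hy =>
    have : torusHom s * y⁻¹ * (torusHom s)⁻¹ = (torusHom s * y * (torusHom s)⁻¹)⁻¹ := by group
    rw [this]
    exact (UE F).inv_mem hy

/-- The conjugate `ᵗχ` of a class function `χ` of `UE₆` by an element `t` of the torus:
`ᵗχ(u) = χ(t⁻¹ u t)`. -/
def torusConj (t : torus F) (χ : UE F → ℂ) : UE F → ℂ := fun u =>
  χ ⟨(t : GL Wt F)⁻¹ * u * t, by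
    have h := torus_conj_mem (inv_mem t.2) u.2
    rwa [inv_inv] at h⟩

/-! ### Characters -/

/-- `χ` is the character of an irreducible complex representation of `G`. -/
def IsIrrChar {G : Type*} [Group G] (χ : G → ℂ) : Prop :=
  ∃ (n : ℕ) (ρ : Representation ℂ G (Fin n → ℂ)), ρ.IsIrreducible ∧ ρ.character = χ

open Classical in
/-- The class function of the finite group `G` induced from a linear character `η` of a subgroup
`K`: `η^G(g) = |K|⁻¹ ∑ η(y⁻¹ g y)`, the sum over all `y ∈ G` with `y⁻¹ g y ∈ K`. -/
noncomputable def ind {G : Type*} [Group G] (K : Subgroup G) (η : K →* ℂˣ) : G → ℂ := fun g =>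
  (Nat.card K : ℂ)⁻¹ * ∑ᶠ y : G, if h : y⁻¹ * g * y ∈ K then (η ⟨y⁻¹ * g * y, h⟩ : ℂ) else 0

/-- The family `𝓕₆`: the irreducible characters `χ` of `UE₆` such that for every positive root `a`
of height `4` the restriction of `χ` to the root subgroup `X_a` is `χ(1) φ_c` for some `c ≠ 0`, where
`φ_c(t) = φ(c t)`. -/
def family (φ : AddChar F ℂ) : Set (UE F → ℂ) :=
  {χ | IsIrrChar χ ∧ ∀ a, IsPosRoot a → ht a = 4 →
    ∃ c : F, c ≠ 0 ∧ ∀ t, χ (x a t) = χ 1 * φ (c * t)}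

/-! ### The quotient `U` and its subgroups -/

variable (F) in
/-- The normal subgroup of `UE₆` generated by all root subgroups of height greater than `4`. -/
def K5 : Subgroup (UE F) :=
  Subgroup.normalClosure {u | ∃ a, IsPosRoot a ∧ 4 < ht a ∧ ∃ t, u = x a t}

instance : (K5 F).Normal := Subgroup.normalClosure_normal

variable (F) in
/-- The quotient `U = UE₆ / K₅`. -/
abbrev U : Type _ := UE F ⧸ K5 F

/-- Inflation of class functions from `U` to `UE₆`. -/
def inflate (χ : U F → ℂ) : UE F → ℂ := fun u => χ (QuotientGroup.mk u)

/-- The positive roots `α₁, …, α₂₁` of height at most `4`. -/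
def root : ℕ → Lat
  | 1 => ![1, 0, 0, 0, 0, 0]
  | 2 => ![0, 1, 0, 0, 0, 0]
  | 3 => ![0, 0, 1, 0, 0, 0]
  | 4 => ![0, 0, 0, 1, 0, 0]
  | 5 => ![0, 0, 0, 0, 1, 0]
  | 6 => ![0, 0, 0, 0, 0, 1]
  | 7 => ![1, 0, 1, 0, 0, 0]
  | 8 => ![0, 1, 0, 1, 0, 0]
  | 9 => ![0, 0, 1, 1, 0, 0]
  | 10 => ![0, 0, 0, 1, 1, 0]
  | 11 => ![0, 0, 0, 0, 1, 1]
  | 12 => ![1, 0, 1, 1, 0, 0]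
  | 13 => ![0, 1, 1, 1, 0, 0]
  | 14 => ![0, 1, 0, 1, 1, 0]
  | 15 => ![0, 0, 1, 1, 1, 0]
  | 16 => ![0, 0, 0, 1, 1, 1]
  | 17 => ![1, 1, 1, 1, 0, 0]
  | 18 => ![1, 0, 1, 1, 1, 0]
  | 19 => ![0, 1, 1, 1, 1, 0]
  | 20 => ![0, 1, 0, 1, 1, 1]
  | 21 => ![0, 0, 1, 1, 1, 1]
  | _ => 0

/-- The element `x_i(t)` of `U`, for `1 ≤ i ≤ 21`. -/
def xU (i : ℕ) (t : F) : U F := QuotientGroup.mk (x (root i) t)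

/-- The indices of the root subgroups of `H = H₄H₃H₂`, where `H₄`, `H₃`, `H₂` are the products of the
`X_i` with `17 ≤ i ≤ 21`, with `12 ≤ i ≤ 16`, and with `8 ≤ i ≤ 10`, respectively. -/
def indexH : Finset ℕ := Finset.Icc 8 10 ∪ Finset.Icc 12 21

variable (F) in
/-- The subgroup `H X₄` of `U`. -/
def HX4 : Subgroup (U F) :=
  Subgroup.closure {u | ∃ i, (i ∈ indexH ∨ i = 4) ∧ ∃ t, u = xU i t}

/-- The elements `s₁(t, r, s)` of `U`. -/
def s1 (t r s : F) : U F :=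
  xU 2 t * xU 1 t * xU 3 (-t) * xU 5 t * xU 6 (-t) * xU 7 r * xU 11 s

/-- The elements `s₂(t)` of `U`. -/
def s2 (t : F) : U F := s1 t (2 * t ^ 2) (2 * t ^ 2)

/-- For a nonzero square `B₂ = c²`, the subgroup `H X₄ F₂` of `U`, where
`F₂ = {1, s₂(c), s₂(-c)}`. -/
def HX4F2 (B₂ : F) : Subgroup (U F) :=
  HX4 F ⊔ Subgroup.closure {u | ∃ c : F, c ^ 2 = B₂ ∧ u = s2 c}

/-! ### The constructed characters

A family `b : ℕ → F` (of which only the entries with indices `8, 9, 10, 12, …, 16` matter)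
describes the linear character `λ` of `H` with `λ(x_i(t)) = φ(b_i t)` for these `i`,
and `λ(x_i(t)) = φ(t)` for `17 ≤ i ≤ 21`. -/

/-- The linear character `η` of a subgroup `K` that contains `H` extends the linear character `λ` of
`H` described by `b`. -/
def Extends (φ : AddChar F ℂ) (b : ℕ → F) (K : Subgroup (U F)) (η : K →* ℂˣ) : Prop :=
  ∀ i ∈ indexH, ∀ (t : F) (h : xU i t ∈ K),
    (η ⟨xU i t, h⟩ : ℂ) = φ ((if 17 ≤ i then 1 else b i) * t)

/-- The invariant `B₃` of `λ`. -/
def B3 (b : ℕ → F) : F := b 12 - b 13 - b 14 + b 15 + b 16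

/-- The invariant `B₂` of `λ`. -/
def B2 (b : ℕ → F) : F := b 10 + b 9 - b 8

/-- The restriction of `λ` to `H₃` is trivial. -/
def TrivialOnH3 (b : ℕ → F) : Prop := ∀ i ∈ Finset.Icc 12 16, b i = 0

/-- `χ` is the character `χ_{q⁷}^{b₄,B₃}`, where `b` describes the chosen representative of the
linear characters of `H` with invariant `B₃ = B3 b`: the character induced (and inflated to `UE₆`)
from the extension `η` of `λ` to `H X₄` with `η(x₄(t)) = φ(b₄ t)`. -/
def IsChiB3 (φ : AddChar F ℂ) (b : ℕ → F) (b₄ : F) (χ : UE F → ℂ) : Prop :=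
  ∃ η : HX4 F →* ℂˣ, Extends φ b (HX4 F) η ∧
    (∀ (t : F) (h : xU 4 t ∈ HX4 F), (η ⟨xU 4 t, h⟩ : ℂ) = φ (b₄ * t)) ∧
    χ = inflate (ind (HX4 F) η)

/-- The extensions to `H X₄` of the linear characters `λ` of `H` that are trivial on `H₃` and have
invariant `B₂`. -/
def extB2 (φ : AddChar F ℂ) (B₂ : F) : Set (HX4 F →* ℂˣ) :=
  {η | ∃ b : ℕ → F, TrivialOnH3 b ∧ B2 b = B₂ ∧ Extends φ b (HX4 F) η}

/-- `χ` is the character `χ_{q⁷}^{B₂}`: the character that is induced (and inflated to `UE₆`) from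
each of the members of `extB2 φ B₂`. -/
def IsChiB2 (φ : AddChar F ℂ) (B₂ : F) (χ : UE F → ℂ) : Prop :=
  (extB2 φ B₂).Nonempty ∧ ∀ η ∈ extB2 φ B₂, χ = inflate (ind (HX4 F) η)

/-- `d` is one of the two possible values of `c_φ` for `B₂ = c²`: it is nonzero and
`d · {t³ - c² t : t ∈ F} = ker φ`. -/
def IsCPhi (φ : AddChar F ℂ) (B₂ d : F) : Prop :=
  d ≠ 0 ∧ {y : F | ∃ t : F, y = d * (t ^ 3 - B₂ * t)} = {y : F | φ y = 1}

/-- For a nonzero square `B₂ = c²`: the extensions `η` to `H X₄ F₂` of the linear characters `λ`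
of `H` that are trivial on `H₃` and have invariant `B₂`, such that the restriction of `η` to
`F₂ = {1, s₂(±c)}` is that of `s₂(t) ↦ φ(e₂ t)` and the restriction of `η` to
`F₄ = {1, x₄(±c_φ)}` is that of `x₄(t) ↦ φ(e₄ t)`. -/
def extF2 (φ : AddChar F ℂ) (B₂ e₂ e₄ : F) : Set (HX4F2 B₂ →* ℂˣ) :=
  {η | (∃ b : ℕ → F, TrivialOnH3 b ∧ B2 b = B₂ ∧ Extends φ b (HX4F2 B₂) η) ∧
    (∀ (c : F) (h : s2 c ∈ HX4F2 B₂), c ^ 2 = B₂ → (η ⟨s2 c, h⟩ : ℂ) = φ (e₂ * c)) ∧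
    ∀ (d : F) (h : xU 4 d ∈ HX4F2 B₂), IsCPhi φ B₂ d → (η ⟨xU 4 d, h⟩ : ℂ) = φ (e₄ * d)}

/-- `χ` is the character `χ_{q⁷/3}^{b₂,b₄,B₂}`, where `a₂` and `a₄` are the elements that identify
`𝔽₃` with the linear characters of `F₂` and of `F₄`: the character that is induced (and inflated
to `UE₆`) from each of the members of `extF2 φ B₂ (b₂ a₂) (b₄ a₄)`. -/
def IsChiThird (φ : AddChar F ℂ) (a₂ a₄ : F) (b₂ b₄ : ZMod 3) (B₂ : F) (χ : UE F → ℂ) : Prop :=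
  (extF2 φ B₂ (b₂.cast * a₂) (b₄.cast * a₄)).Nonempty ∧
    ∀ η ∈ extF2 φ B₂ (b₂.cast * a₂) (b₄.cast * a₄), χ = inflate (ind (HX4F2 B₂) η)

/-- `B₂` is the square of a nonzero element. -/
def IsNonzeroSquare (B₂ : F) : Prop := ∃ c : F, c ≠ 0 ∧ B₂ = c ^ 2

/-- Auxiliary choices that enter the labelling of the characters: for every `B₃ ≠ 0` a linear
character of `H` with invariant `B₃` (described by `rep B₃`), and for every nonzero square `B₂ = c²`
elements `a₂`, `a₄` with `φ(a₂ c) ≠ 1` and `φ(a₄ c_φ) ≠ 1`. -/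
structure Labelling (φ : AddChar F ℂ) where
  rep : F → ℕ → F
  B3_rep : ∀ B₃ : F, B₃ ≠ 0 → B3 (rep B₃) = B₃
  a₂ : F → F
  a₂_spec : ∀ c : F, c ≠ 0 → φ (a₂ (c ^ 2) * c) ≠ 1
  a₄ : F → F
  a₄_spec : ∀ c d : F, c ≠ 0 → IsCPhi φ (c ^ 2) d → φ (a₄ (c ^ 2) * d) ≠ 1

/-- Such choices exist. -/
theorem Labelling.nonempty [CharP F 3] (φ : AddChar F ℂ) (hφ : φ ≠ 1) :
    Nonempty (Labelling φ) := by
  classical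
  obtain ⟨y, hy⟩ : ∃ y, φ y ≠ 1 := by
    by_contra! h
    exact hφ (by ext z; simpa using h z)
  have hy' : φ (-y) ≠ 1 := by
    rw [AddChar.map_neg_eq_inv]
    simpa using hy
  have h2 : ∀ B : F, ∃ a : F, ∀ c : F, c ≠ 0 → c ^ 2 = B → φ (a * c) ≠ 1 := by
    intro B
    by_cases hB : ∃ c₀ : F, c₀ ≠ 0 ∧ c₀ ^ 2 = B
    · obtain ⟨c₀, h0, rfl⟩ := hB
      refine ⟨y / c₀, fun c _ hc => ?_⟩
      rcases sq_eq_sq_iff_eq_or_eq_neg.mp hc with rfl | rfl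
      · rwa [div_mul_cancel₀ _ h0]
      · rwa [mul_neg, div_mul_cancel₀ _ h0]
    · exact ⟨0, fun c h0 hc => (hB ⟨c, h0, hc⟩).elim⟩
  have h4 : ∀ B : F, ∃ a : F, ∀ d : F, IsCPhi φ B d → φ (a * d) ≠ 1 := by
    intro B
    by_cases hB : ∃ d₀ : F, IsCPhi φ B d₀
    · obtain ⟨d₀, h0, hd₀⟩ := hB
      refine ⟨y / d₀, fun d hd h1 => ?_⟩
      have hmem : y / d₀ * d ∈ {y : F | φ y = 1} := h1
      rw [← hd.2] at hmem
      obtain ⟨t, ht⟩ := hmem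
      have hyt : y / d₀ = t ^ 3 - B * t := mul_right_cancel₀ hd.1 (by rw [ht]; ring)
      have : y ∈ {y : F | φ y = 1} := by
        rw [← hd₀]
        exact ⟨t, by rw [← hyt, mul_div_cancel₀ _ h0]⟩
      exact hy this
    · exact ⟨0, fun d hd => (hB ⟨d, hd⟩).elim⟩
  choose a₂ ha₂ using h2
  choose a₄ ha₄ using h4
  exact ⟨⟨fun B i => if i = 12 then B else 0, fun B _ => by simp [B3], a₂,
    fun c hc => ha₂ _ c hc rfl, a₄, fun c d _ hd => ha₄ _ d hd⟩⟩

end E6Sylow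

open E6Sylow

namespace E6Sylow

/-! ### The root lattice -/

/-! The proof is Clifford theory for the abelian subgroup `HX4` of `U`. The torus rescales `χ` so
that all root subgroups of height 4 act through `φ`. Commutators of these scalars with simple root
elements are trivial, so `K5` acts trivially and `χ` is afforded by an irreducible representation of
`U` (`exists_representation_U`). The commuting operators from `HX4` have a common eigenvector, with
eigenvalues `φ(b_i t)` on `X_i`. Translating it by elements of `U` changes the parameters `b` by
explicit formulas (`move`), and the theorem becomes a study of the orbits of `b`.

The subgroups `X₁, X₃, X₅, X₆` translate `(b₁₂, …, b₁₆)` along the level sets of `B₃`. In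
characteristic 3 the elements `s₁(t,r,s)` fix these five parameters; they change `B₂` by `-t B₃`,
while `r` and `s` adjust `b₈, b₉, b₁₀` with `B₂` fixed. If `B₃ ≠ 0`, all parameters on `H` are
therefore determined by `B₃` up to conjugacy. If `B₃ = 0`, one may assume `b₁₂ = … = b₁₆ = 0`; then
`s₂(t)` fixes all parameters on `H` and subtracts `t³ - B₂ t` from `b₄`. This additive map of `t` is
bijective unless `B₂ = c²` with `c ≠ 0`, when its kernel is `{0, ±c}` and `s₂(±c)` preserves the
eigenspace.

The degree separates the cases. An orbit of `q⁷` different parameters forces degree at least `q⁷`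
(`pow_seven_le_finrank`). An eigenvector of a subgroup `K` forces degree at most the index of `K`
(`finrank_le_index`), and in case of equality the character is induced from `K`
(`character_eq_ind`). The groups used are `HX4`, of index at most `q⁷`, and `HX4F2`, of index at
most `q⁷/3`. That every admissible linear character induces to the same `χ` follows by translating
the eigenvector to one that affords it. In the square case this uses `c_φ · {t³ - c² t} = ker φ`:
agreement at `x₄(c_φ)` means that the two values of `b₄` differ by some `t³ - c² t`, and the
translating element can be chosen to commute with `F₂`. -/

theorem ip_eq (a b : Lat) : ip a b =
    2 * (a 0 * b 0 + a 1 * b 1 + a 2 * b 2 + a 3 * b 3 + a 4 * b 4 + a 5 * b 5)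
    - (a 0 * b 2 + a 2 * b 0) - (a 2 * b 3 + a 3 * b 2) - (a 3 * b 4 + a 4 * b 3)
    - (a 4 * b 5 + a 5 * b 4) - (a 1 * b 3 + a 3 * b 1) := by
  simp [ip, Fin.sum_univ_six, CartanMatrix.E₆]
  ring

theorem ip_comm (a b : Lat) : ip a b = ip b a := by
  simp only [ip_eq]; ring

theorem ip_self_add (a b : Lat) : ip (a + b) (a + b) = ip a a + 2 * ip a b + ip b b := by
  rw [ip_add_add, ip_comm b a]; ring

theorem ip_add_left (a b c : Lat) : ip (a + b) c = ip a c + ip b c := by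
  simp only [ip_eq, Pi.add_apply]; ring

/-- The norm of the vector `ω₁ + d`, minus the norm of `ω₁`. -/
def wq (d : Lat) : ℤ := ip d d + 2 * d 0

/-- The weights of a minuscule representation are the shortest vectors of their coset. Over the
reals the minimum of `wq` is `-4/3`, minus the norm of `ω₁`, and `wq` takes even values on the
lattice. -/
theorem wq_nonneg (d : Lat) : 0 ≤ wq d := by
  have h : -2 < wq d := by
    rw [wq, ip_eq]
    nlinarith [sq_nonneg (2 * d 5 - d 4), sq_nonneg (3 * d 4 - 2 * d 3),
      sq_nonneg (2 * d 1 - d 3), sq_nonneg (5 * d 3 - 6 * d 2), sq_nonneg (4 * d 2 - 5 * d 0),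
      sq_nonneg (3 * d 0 + 4)]
  have h2 : wq d = 2 * (d 0 * d 0 + d 1 * d 1 + d 2 * d 2 + d 3 * d 3 + d 4 * d 4 + d 5 * d 5
      - d 0 * d 2 - d 2 * d 3 - d 3 * d 4 - d 4 * d 5 - d 1 * d 3 + d 0) := by
    rw [wq, ip_eq]; ring
  omega

theorem ip_self_nonneg (d : Lat) : 0 ≤ ip d d := by
  rw [ip_eq]
  nlinarith [sq_nonneg (2 * d 5 - d 4), sq_nonneg (3 * d 4 - 2 * d 3),
      sq_nonneg (2 * d 1 - d 3), sq_nonneg (5 * d 3 - 6 * d 2), sq_nonneg (4 * d 2 - 5 * d 0),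
      sq_nonneg (d 0)]

theorem eq_zero_of_ip_self (d : Lat) (h : ip d d = 0) : d = 0 := by
  rw [ip_eq] at h
  -- Completion of squares for the form, cleared of denominators; all six squares must vanish.
  have e : 120 * (d 5 * 2 - d 4) ^ 2 + 40 * (d 4 * 3 - d 3 * 2) ^ 2 + 120 * (d 1 * 2 - d 3) ^ 2
    + 8 * (d 3 * 5 - d 2 * 6) ^ 2 + 12 * (d 2 * 4 - d 0 * 5) ^ 2 + 180 * d 0 ^ 2 = 0 := by
    linear_combination 240 * h
  have p5 := sq_nonneg (d 5 * 2 - d 4)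
  have p4 := sq_nonneg (d 4 * 3 - d 3 * 2)
  have p1 := sq_nonneg (d 1 * 2 - d 3)
  have p3 := sq_nonneg (d 3 * 5 - d 2 * 6)
  have p2 := sq_nonneg (d 2 * 4 - d 0 * 5)
  have p0 := sq_nonneg (d 0)
  have h0 : d 0 = 0 := (pow_eq_zero_iff two_ne_zero).1 (by linarith)
  have h2 : d 2 * 4 - d 0 * 5 = 0 := (pow_eq_zero_iff two_ne_zero).1 (by linarith)
  have h3 : d 3 * 5 - d 2 * 6 = 0 := (pow_eq_zero_iff two_ne_zero).1 (by linarith)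
  have h1 : d 1 * 2 - d 3 = 0 := (pow_eq_zero_iff two_ne_zero).1 (by linarith)
  have h4 : d 4 * 3 - d 3 * 2 = 0 := (pow_eq_zero_iff two_ne_zero).1 (by linarith)
  have h5 : d 5 * 2 - d 4 = 0 := (pow_eq_zero_iff two_ne_zero).1 (by linarith)
  ext i
  fin_cases i <;> simp <;> omega

/-! ### Signs -/

theorem signForm_add_swap (a b : Lat) : signForm a b + signForm b a = ip a b := by
  simp [signForm, ip_eq, Fin.sum_univ_six, CartanMatrix.E₆]
  ring

theorem signForm_add_left (a b c : Lat) :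
    signForm (a + b) c = signForm a c + signForm b c := by
  simp [signForm, Fin.sum_univ_six, CartanMatrix.E₆]
  ring

theorem signForm_add_right (a b c : Lat) :
    signForm a (b + c) = signForm a b + signForm a c := by
  simp [signForm, Fin.sum_univ_six, CartanMatrix.E₆]
  ring

theorem sgn_add_left (a b c : Lat) : sgn (a + b) c = sgn a c * sgn b c := by
  simp [sgn, signForm_add_left, Int.negOnePow_add]

theorem sgn_add_right (a b c : Lat) : sgn a (b + c) = sgn a b * sgn a c := by
  simp [sgn, signForm_add_right, Int.negOnePow_add]

theorem sgn_mul_self (a b : Lat) : sgn a b * sgn a b = 1 := by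
  rw [sgn, ← Units.val_mul, Int.units_mul_self, Units.val_one]

theorem sgn_swap (a b : Lat) : sgn a b * sgn b a = ((ip a b).negOnePow : ℤˣ) := by
  rw [sgn, sgn, ← Units.val_mul, ← Int.negOnePow_add, signForm_add_swap]

theorem sgn_swap_even (a b : Lat) (h : ip a b = 0) : sgn b a = sgn a b := by
  have := sgn_swap a b
  rw [h] at this
  simp only [Int.negOnePow_zero, Units.val_one] at this
  linear_combination sgn a b * this - sgn b a * sgn_mul_self a b

theorem sgn_swap_odd (a b : Lat) (h : ip a b = -1) : sgn b a = -sgn a b := by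
  have := sgn_swap a b
  rw [h] at this
  simp only [Int.negOnePow_neg, Int.negOnePow_one, Units.val_neg, Units.val_one] at this
  linear_combination sgn a b * this - sgn b a * sgn_mul_self a b

/-! ### Products of root vectors -/

theorem Wt.diff_injective : Function.Injective Wt.diff := by
  intro v w h
  apply Subtype.ext
  funext i
  have := congrFun h i
  simp only [Wt.diff, neg_inj] at this
  exact Fin.ext (by exact_mod_cast this)

theorem Wt.wq_diff (v : Wt) : wq v.diff = 0 := by
  rw [wq, Wt.ip_diff]; ring

theorem wq_add (d a : Lat) (ha : IsRoot a) : wq (d + a) = wq d + 2 * (ip d a + a 0 + 1) := by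
  have : ip a a = 2 := ha
  simp only [wq, ip_self_add, Pi.add_apply, this]; ring

/-- The norm condition characterizes weights; the sandwich between two known weights supplies the
bounds `0` and `4` on the coefficients that the type `Wt` demands. -/
theorem Wt.exists_diff_eq (v w : Wt) (d : Lat) (h1 : v.diff ≤ d) (h2 : d ≤ w.diff)
    (h : wq d = 0) : ∃ u : Wt, u.diff = d := by
  have hb : ∀ i, d i ≤ 0 ∧ -4 ≤ d i := fun i => by
    have h1 := h1 i
    have h2 := h2 i
    simp only [Wt.diff] at h1 h2
    have := (v.1 i).2
    constructor <;> omega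
  have hc : (fun i => (((⟨(-d i).toNat, by have := hb i; omega⟩ : Fin 5) : ℕ) : ℤ)) = -d := by
    funext i
    have := hb i
    simp only [Pi.neg_apply]
    omega
  refine ⟨⟨fun i => ⟨(-d i).toNat, by have := hb i; omega⟩, ?_⟩, ?_⟩
  · have h0 := congrFun hc 0
    rw [hc, h0]
    rw [wq] at h
    have : ip (-d) (-d) = ip d d := by simp only [ip_eq, Pi.neg_apply]; ring
    rw [this, Pi.neg_apply]
    linarith
  · funext i
    have := congrFun hc i
    simp only [Wt.diff, Pi.neg_apply] at this ⊢
    omega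

section RootVec

variable (F : Type*) [Field F]

/-- At most one intermediate weight contributes, namely `v + b`, and it is a weight exactly when
`wq` vanishes there. This turns products of root vectors into arithmetic with `wq`. -/
theorem rootVec_mul_apply (a b : Lat) (ha : 0 ≤ a) (hb : 0 ≤ b) (w v : Wt) :
    (rootVec F a * rootVec F b) w v =
      if w.diff = v.diff + b + a ∧ wq (v.diff + b) = 0 then
        ((sgn a (v.diff + b) * sgn b v.diff : ℤ) : F) else 0 := by
  rw [Matrix.mul_apply]
  split_ifs with h
  · obtain ⟨u, hu⟩ := v.exists_diff_eq w (v.diff + b) (le_add_of_nonneg_right hb)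
      (by rw [h.1]; exact le_add_of_nonneg_right ha) h.2
    rw [Finset.sum_eq_single u]
    · simp [rootVec, hu, h.1]
    · intro u' _ hne
      have : u'.diff ≠ v.diff + b := fun e => hne (Wt.diff_injective (e.trans hu.symm))
      simp [rootVec, this]
    · simp
  · refine Finset.sum_eq_zero fun u _ => ?_
    simp only [rootVec, Matrix.of_apply]
    split_ifs with h1 h2
    · exact absurd ⟨by rw [h1, h2], by rw [← h2]; exact u.wq_diff⟩ h
    all_goals simp

theorem rootVec_commute (a b : Lat) (ha : IsPosRoot a) (hb : IsPosRoot b) (h : 0 ≤ ip a b) :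
    rootVec F a * rootVec F b = rootVec F b * rootVec F a := by
  ext w v
  rw [rootVec_mul_apply _ _ _ ha.2 hb.2, rootVec_mul_apply _ _ _ hb.2 ha.2]
  by_cases hw : w.diff = v.diff + a + b
  · have hw' : w.diff = v.diff + b + a := by rw [hw]; abel
    have e1 := wq_add v.diff a ha.1
    have e2 := wq_add v.diff b hb.1
    have e3 := wq_add (v.diff + a) b hb.1
    have n1 := wq_nonneg (v.diff + a)
    have n2 := wq_nonneg (v.diff + b)
    rw [← hw, w.wq_diff, ip_add_left] at e3
    rw [v.wq_diff] at e1 e2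
    -- For `w = v + a + b` one has `0 = wq (v + a) + wq (v + b) + 2 (a, b)` with nonnegative
    -- summands, so all vanish: both paths from `v` to `w` exist, with equal signs.
    have h0 : ip a b = 0 := by omega
    have z1 : wq (v.diff + a) = 0 := by omega
    have z2 : wq (v.diff + b) = 0 := by omega
    rw [if_pos ⟨hw', z2⟩, if_pos ⟨hw, z1⟩, sgn_add_right, sgn_add_right, sgn_swap_even a b h0]
    congr 1
    ring
  · have hw' : w.diff ≠ v.diff + b + a := fun e => hw (by rw [e]; abel)
    simp [hw, hw']

theorem rootVec_commutator (a b : Lat) (ha : IsPosRoot a) (hb : IsPosRoot b) (h : ip a b = -1) :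
    rootVec F a * rootVec F b =
      rootVec F b * rootVec F a + ((sgn a b : ℤ) : F) • rootVec F (a + b) := by
  ext w v
  rw [Matrix.add_apply, Matrix.smul_apply, rootVec_mul_apply _ _ _ ha.2 hb.2,
    rootVec_mul_apply _ _ _ hb.2 ha.2]
  simp only [rootVec, Matrix.of_apply]
  by_cases hw : w.diff = v.diff + a + b
  · have hw' : w.diff = v.diff + b + a := by rw [hw]; abel
    have hw2 : w.diff = v.diff + (a + b) := by rw [hw]; abel
    have e1 := wq_add v.diff a ha.1
    have e2 := wq_add v.diff b hb.1
    have e3 := wq_add (v.diff + a) b hb.1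
    have n1 := wq_nonneg (v.diff + a)
    have n2 := wq_nonneg (v.diff + b)
    rw [← hw, w.wq_diff, ip_add_left] at e3
    rw [v.wq_diff] at e1 e2
    have hs := sgn_mul_self a b
    -- Here `wq (v + a) + wq (v + b) = 2` with both terms even and nonnegative, so exactly one of
    -- the two paths from `v` to `w` exists.
    by_cases z1 : wq (v.diff + a) = 0
    · have z2 : wq (v.diff + b) ≠ 0 := by omega
      rw [if_neg (fun h => z2 h.2), if_pos ⟨hw, z1⟩, if_pos hw2, sgn_add_right, sgn_add_left,
        sgn_swap_odd a b h, smul_eq_mul]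
      push_cast
      ring
    · have z2 : wq (v.diff + b) = 0 := by omega
      rw [if_pos ⟨hw', z2⟩, if_neg (fun h => z1 h.2), if_pos hw2, sgn_add_right, sgn_add_left,
        smul_eq_mul]
      push_cast
      ring
  · have hw' : w.diff ≠ v.diff + b + a := fun e => hw (by rw [e]; abel)
    have hw2 : w.diff ≠ v.diff + (a + b) := fun e => hw (by rw [e]; abel)
    simp [hw, hw', hw2]

/-- If `v`, `v + a + b` and `v + a + 2b` were all weights, then `wq (v + b)` would be `-2`, which is
impossible. -/
theorem rootVec_mul_add_eq_zero (a b : Lat) (ha : IsPosRoot a) (hb : IsPosRoot b)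
    (h : ip a b = -1) : rootVec F b * rootVec F (a + b) = 0 := by
  ext w v
  rw [rootVec_mul_apply _ _ _ hb.2 (add_nonneg ha.2 hb.2), if_neg, Matrix.zero_apply]
  rintro ⟨hw, z⟩
  have e0 := wq_add v.diff b hb.1
  have e1 := wq_add v.diff a ha.1
  have e2 := wq_add (v.diff + a) b hb.1
  have e3 := wq_add (v.diff + (a + b)) b hb.1
  rw [add_assoc, z, e1] at e2
  rw [← hw, w.wq_diff, z] at e3
  have n1 := wq_nonneg (v.diff + b)
  have hb2 : ip b b = 2 := hb.1
  have e4 := wq_add (v.diff + b) b hb.1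
  have n2 := wq_nonneg (v.diff + b + b)
  simp only [ip_add_left, h, hb2] at e2 e3 e4
  have := v.wq_diff
  have n3 := wq_nonneg (v.diff + a)
  omega

end RootVec

/-! ### Relations between root elements -/

/-- Chevalley's commutator formula in abstract form: since `C` kills `A` and `B` from the left, all
terms beyond `A * B`, `B * A` and `C` vanish. -/
theorem one_add_smul_mul_one_add_smul {F R : Type*} [Field F] [Ring R] [Algebra F R]
    (A B C : R) (s t u : F) (h : A * B = B * A + s • C) (hB : C * B = 0) (hA : C * A = 0) :
    (1 + t • A) * (1 + u • B) = (1 + (s * t * u) • C) * ((1 + u • B) * (1 + t • A)) := by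
  have hBA : C * (B * A) = 0 := by rw [← mul_assoc, hB, zero_mul]
  simp only [mul_add, add_mul, one_mul, mul_one, smul_mul_assoc, mul_smul_comm, hB, hA, hBA, h,
    smul_zero, smul_add]
  module

variable {F : Type*} [Field F]

theorem IsPosRoot.add {a b : Lat} (ha : IsPosRoot a) (hb : IsPosRoot b) (h : ip a b = -1) :
    IsPosRoot (a + b) := by
  refine ⟨?_, fun i => add_nonneg (ha.2 i) (hb.2 i)⟩
  have h1 : ip a a = 2 := ha.1
  have h2 : ip b b = 2 := hb.1
  rw [IsRoot, ip_self_add, h, h1, h2]; norm_num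

theorem x_val {a : Lat} (ha : IsPosRoot a) (t : F) :
    ((x a t : UE F) : GL Wt F).val = 1 + t • rootVec F a := by
  rw [x, dif_pos ha]
  simp [rootElt, ha.1]

theorem x_eq_iff (g h : UE F) : g = h ↔ (g : GL Wt F).val = (h : GL Wt F).val := by
  rw [← Units.ext_iff, Subtype.ext_iff]

theorem x_add (a : Lat) (t u : F) : x a (t + u) = x a t * x a u := by
  by_cases ha : IsPosRoot a
  · rw [x_eq_iff, Subgroup.coe_mul, Units.val_mul, x_val ha, x_val ha, x_val ha]
    simp [mul_add, add_mul, rootVec_sq F a ha.1, add_smul]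
    abel
  · simp [x, ha]

theorem x_zero (a : Lat) : x a (0 : F) = 1 := by
  have := x_add a (0 : F) 0
  rw [add_zero] at this
  exact left_eq_mul.1 this

theorem x_neg (a : Lat) (t : F) : x a (-t) = (x a t)⁻¹ := by
  rw [eq_inv_iff_mul_eq_one, ← x_add, neg_add_cancel, x_zero]

theorem x_commute {a b : Lat} (ha : IsPosRoot a) (hb : IsPosRoot b) (h : 0 ≤ ip a b) (t u : F) :
    x a t * x b u = x b u * x a t := by
  rw [x_eq_iff]
  simp only [Subgroup.coe_mul, Units.val_mul, x_val ha, x_val hb, mul_add, add_mul, one_mul,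
    mul_one, smul_mul_assoc, mul_smul_comm, rootVec_commute F a b ha hb h]
  module

theorem x_mul {a b : Lat} (ha : IsPosRoot a) (hb : IsPosRoot b) (h : ip a b = -1) (t u : F) :
    x a t * x b u = x (a + b) ((sgn a b : ℤ) * t * u) * (x b u * x a t) := by
  have hab := ha.add hb h
  have h1 : ip a a = 2 := ha.1
  have h2 : ip b b = 2 := hb.1
  rw [x_eq_iff]
  simp only [Subgroup.coe_mul, Units.val_mul, x_val ha, x_val hb, x_val hab]
  refine one_add_smul_mul_one_add_smul _ _ _ _ _ _ (rootVec_commutator F a b ha hb h) ?_ ?_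
  · rw [rootVec_commute F _ _ hab hb (by rw [ip_add_left, h, h2]; norm_num)]
    exact rootVec_mul_add_eq_zero F a b ha hb h
  · rw [rootVec_commute F _ _ hab ha (by rw [ip_add_left, h1, ip_comm, h]; norm_num), add_comm]
    exact rootVec_mul_add_eq_zero F b a hb ha (by rw [ip_comm, h])

/-! ### Heights -/

/-- The simple roots. -/
def simpleRoot (i : Fin 6) : Lat := Pi.single i 1

theorem simpleRoot_isPosRoot : ∀ i, IsPosRoot (simpleRoot i) := by decide

theorem ht_add (a b : Lat) : ht (a + b) = ht a + ht b := by
  simp [ht, Finset.sum_add_distrib]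

theorem ht_simpleRoot (i : Fin 6) : ht (simpleRoot i) = 1 := by
  simp [ht, simpleRoot]

/-- A positive root that is not simple is the sum of a positive root and a simple root. -/
theorem IsPosRoot.exists_add_simpleRoot {a : Lat} (ha : IsPosRoot a) (h : ht a ≠ 1) :
    ∃ b i, IsPosRoot b ∧ ip b (simpleRoot i) = -1 ∧ a = b + simpleRoot i := by
  have h2 : ip a a = 2 := ha.1
  have hsum : ip a a = ∑ i, a i * ip a (simpleRoot i) := by
    simp [Fin.sum_univ_six, ip_eq, simpleRoot, Pi.single_apply]
    ring
  -- The terms `a_i (a, α_i)` add up to `(a, a) = 2`. A positive one gives `(a, α_i) = 1`, as the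
  -- value `2` would mean `a = α_i`, and then `a - α_i` is a root.
  obtain ⟨i, hi⟩ : ∃ i, 0 < a i * ip a (simpleRoot i) := by
    by_contra! hc
    have := Finset.sum_nonpos fun i (_ : i ∈ Finset.univ) => hc i
    omega
  have hai : 0 < a i := (ha.2 i).lt_of_ne fun h => by simp [← h] at hi
  have hip : 0 < ip a (simpleRoot i) := pos_of_mul_pos_right hi hai.le
  have hs2 : ip (simpleRoot i) (simpleRoot i) = 2 := (simpleRoot_isPosRoot i).1
  have hsub : ip (a - simpleRoot i) (a - simpleRoot i) = 4 - 2 * ip a (simpleRoot i) := by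
    have := ip_self_add (a - simpleRoot i) (simpleRoot i)
    have h' := ip_add_left (a - simpleRoot i) (simpleRoot i) (simpleRoot i)
    rw [sub_add_cancel] at this h'
    linarith
  have hn := ip_self_nonneg (a - simpleRoot i)
  have hne : ip a (simpleRoot i) ≠ 2 := fun h' => by
    rw [h'] at hsub
    have := sub_eq_zero.1 (eq_zero_of_ip_self _ hsub)
    exact h (by rw [this, ht_simpleRoot])
  have h1 : ip a (simpleRoot i) = 1 := by omega
  refine ⟨a - simpleRoot i, i, ⟨by rw [IsRoot, hsub, h1]; norm_num, fun j => ?_⟩, ?_, by abel⟩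
  · by_cases hj : j = i
    · subst hj; simp [simpleRoot]; omega
    · simpa [simpleRoot, hj] using ha.2 j
  · have h' := ip_add_left (a - simpleRoot i) (simpleRoot i) (simpleRoot i)
    rw [sub_add_cancel] at h'
    linarith

theorem IsPosRoot.ht_pos {a : Lat} (ha : IsPosRoot a) : 0 < ht a := by
  refine (Finset.sum_nonneg fun i _ => ha.2 i).lt_of_ne fun h => ?_
  have h0 : a = 0 := by
    funext i
    exact (Finset.sum_eq_zero_iff_of_nonneg fun i _ => ha.2 i).1 h.symm i (Finset.mem_univ i)
  have := ha.1
  rw [h0] at this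
  simp [IsRoot, ip] at this

theorem root_isPosRoot : ∀ i ∈ Finset.Icc 1 21, IsPosRoot (root i) := by decide

theorem exists_root_eq_simpleRoot : ∀ i, ∃ j ∈ Finset.Icc 1 6, root j = simpleRoot i := by decide

theorem exists_root_eq_add : ∀ i ∈ Finset.Icc 1 16, ∀ j, ip (root i) (simpleRoot j) = -1 →
    ∃ k ∈ Finset.Icc 1 21, root k = root i + simpleRoot j := by decide

theorem ht_root : ∀ i ∈ Finset.Icc 17 21, ht (root i) = 4 := by decide

theorem exists_root_eq : ∀ n : ℕ, ∀ a : Lat, IsPosRoot a → ht a = n → n ≤ 4 →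
    ∃ i ∈ Finset.Icc 1 21, root i = a := by
  intro n
  induction n with
  | zero => intro a ha h _; have := ha.ht_pos; simp [h] at this
  | succ n ih =>
    intro a ha h hn
    by_cases h1 : ht a = 1
    · obtain ⟨i, hi⟩ : ∃ i, a i ≠ 0 := by
        by_contra! h0
        simp [ht, h0] at h1
      have hle : ∀ j, j ≠ i → a j = 0 := by
        intro j hj
        have h2 : a i + a j ≤ ht a := by
          rw [← Finset.sum_pair hj.symm]
          exact Finset.sum_le_sum_of_subset_of_nonneg (Finset.subset_univ _) fun k _ _ => ha.2 k
        have := ha.2 j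
        have := ha.2 i
        omega
      have hai : a i = 1 := by
        rw [← h1, ht, Finset.sum_eq_single i (fun j _ hj => hle j hj) (by simp)]
      obtain ⟨j, hj, e⟩ := exists_root_eq_simpleRoot i
      refine ⟨j, Finset.Icc_subset_Icc_right (by norm_num) hj, ?_⟩
      rw [e]
      funext k
      by_cases hk : k = i
      · subst hk; simp [simpleRoot, hai]
      · simp [simpleRoot, hk, hle k hk]
    · obtain ⟨b, i, hb, hbi, rfl⟩ := ha.exists_add_simpleRoot h1
      rw [ht_add, ht_simpleRoot] at h
      push_cast at h
      obtain ⟨j, hj, rfl⟩ := ih b hb (by linarith) (by omega)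
      refine exists_root_eq_add j ?_ i hbi
      simp only [Finset.mem_Icc] at hj ⊢
      refine ⟨hj.1, ?_⟩
      by_contra hc
      have := ht_root j (by simp; omega)
      omega

/-! ### Relations in `U` -/

theorem xU_add (i : ℕ) (t u : F) : xU i (t + u) = xU i t * xU i u := by
  rw [xU, x_add]; rfl

theorem xU_zero (i : ℕ) : xU i (0 : F) = 1 := by
  rw [xU, x_zero]; rfl

theorem xU_neg (i : ℕ) (t : F) : xU i (-t) = (xU i t)⁻¹ := by
  rw [xU, x_neg]; rfl

theorem mk_x_eq_one {a : Lat} (ha : IsPosRoot a) (h : 4 < ht a) (t : F) :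
    (QuotientGroup.mk (x a t) : U F) = 1 :=
  (QuotientGroup.eq_one_iff _).2 (Subgroup.subset_normalClosure ⟨a, ha, h, t, rfl⟩)

/-- The elements of `X_i` and `X_j` commute in `U`, because `α_i + α_j` is not a root of height at
most `4`. -/
def Comm (i j : ℕ) : Prop :=
  0 ≤ ip (root i) (root j) ∨ (ip (root i) (root j) = -1 ∧ 4 < ht (root i + root j))

instance (i j : ℕ) : Decidable (Comm i j) := inferInstanceAs (Decidable (_ ∨ _))

theorem xU_commute {i j : ℕ} (hi : i ∈ Finset.Icc 1 21) (hj : j ∈ Finset.Icc 1 21)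
    (h : Comm i j) (t u : F) : xU i t * xU j u = xU j u * xU i t := by
  have hi := root_isPosRoot i hi
  have hj := root_isPosRoot j hj
  simp only [xU, ← QuotientGroup.mk_mul]
  rcases h with h | ⟨h, h'⟩
  · rw [x_commute hi hj h]
  · rw [x_mul hi hj h, QuotientGroup.mk_mul, mk_x_eq_one (hi.add hj h) h', one_mul]

theorem xU_mul {i j k : ℕ} (hi : i ∈ Finset.Icc 1 21) (hj : j ∈ Finset.Icc 1 21)
    (h : ip (root i) (root j) = -1) (hk : root k = root i + root j) (t u : F) :
    xU i t * xU j u = xU k ((sgn (root i) (root j) : ℤ) * t * u) * (xU j u * xU i t) := by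
  have hi := root_isPosRoot i hi
  have hj := root_isPosRoot j hj
  simp only [xU, ← QuotientGroup.mk_mul, hk]
  rw [x_mul hi hj h]

/-! ### Subgroups generated by root subgroups -/

variable (F) in
/-- The subgroup of `U` generated by the `X_i` with `i ∈ S`. -/
def gen (S : Finset ℕ) : Subgroup (U F) :=
  Subgroup.closure {u | ∃ i, i ∈ S ∧ ∃ t, u = xU i t}

theorem xU_mem_gen {S : Finset ℕ} {i : ℕ} (hi : i ∈ S) (t : F) : xU i t ∈ gen F S :=
  Subgroup.subset_closure ⟨i, hi, t, rfl⟩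

theorem gen_le {S : Finset ℕ} {N : Subgroup (U F)} (h : ∀ i ∈ S, ∀ t : F, xU i t ∈ N) :
    gen F S ≤ N := by
  rw [gen, Subgroup.closure_le]
  rintro _ ⟨i, hi, t, rfl⟩
  exact h i hi t

theorem gen_Icc : gen F (Finset.Icc 1 21) = ⊤ := by
  rw [eq_top_iff]
  intro u _
  obtain ⟨⟨g, hg⟩, rfl⟩ := QuotientGroup.mk_surjective u
  induction hg using Subgroup.closure_induction with
  | mem g hg =>
    obtain ⟨a, ha, t, rfl⟩ := hg
    have e : (⟨rootElt F a t, Subgroup.subset_closure ⟨a, ha, t, rfl⟩⟩ : UE F) = x a t := by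
      rw [x, dif_pos ha]
    rw [e]
    by_cases h : 4 < ht a
    · rw [mk_x_eq_one ha h]
      exact one_mem _
    · obtain ⟨i, hi, rfl⟩ := exists_root_eq (ht a).toNat a ha (by have := ha.ht_pos; omega)
        (by omega)
      exact xU_mem_gen hi t
  | one => exact one_mem _
  | mul a b ha hb iha ihb => exact mul_mem (iha (Subgroup.mem_top _)) (ihb (Subgroup.mem_top _))
  | inv a ha iha => exact inv_mem (iha (Subgroup.mem_top _))

/-- The root subgroup `X_j` normalizes the group generated by the `X_i` with `i ∈ S`. -/
def Normalizes (j : ℕ) (S : Finset ℕ) : Prop :=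
  ∀ i ∈ S, Comm j i ∨ (ip (root j) (root i) = -1 ∧ ∃ k ∈ S, root k = root j + root i)

instance (j : ℕ) (S : Finset ℕ) : Decidable (Normalizes j S) :=
  inferInstanceAs (Decidable (∀ i ∈ S, _))

theorem Normalizes.conj_mem {j : ℕ} {S : Finset ℕ} (h : Normalizes j S)
    (hS : S ⊆ Finset.Icc 1 21) (hj : j ∈ Finset.Icc 1 21) (s : F) {n : U F} (hn : n ∈ gen F S) :
    xU j s * n * (xU j s)⁻¹ ∈ gen F S := by
  have : gen F S ≤ (gen F S).comap (MulAut.conj (xU j s)).toMonoidHom := by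
    refine gen_le fun i hi t => ?_
    rw [Subgroup.mem_comap]
    simp only [MulEquiv.coe_toMonoidHom, MulAut.conj_apply]
    rcases h i hi with h' | ⟨h', k, hk, e⟩
    · rw [xU_commute hj (hS hi) h', mul_inv_cancel_right]
      exact xU_mem_gen hi t
    · rw [xU_mul hj (hS hi) h' e, ← mul_assoc, mul_inv_cancel_right]
      exact mul_mem (xU_mem_gen hk _) (xU_mem_gen hi t)
  exact this hn

instance [Finite F] : Finite (UE F) := by
  have : Finite (GL Wt F) := inferInstance
  infer_instance

/-- As `X_j` normalizes the group generated by `S`, the larger group is the product of the two. Only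
upper bounds on orders are ever needed, so uniqueness of the factorization plays no role. -/
theorem card_gen_insert_le [Finite F] {j : ℕ} {S : Finset ℕ} (h : Normalizes j S)
    (hS : S ⊆ Finset.Icc 1 21) (hj : j ∈ Finset.Icc 1 21) :
    Nat.card (gen F (insert j S)) ≤ Nat.card (gen F S) * Nat.card F := by
  have key : ∀ u ∈ gen F (insert j S), ∃ n ∈ gen F S, ∃ t, u = n * xU j t := by
    intro u hu
    have step : ∀ i ∈ insert j S, ∀ (s : F) (y : U F), (∃ n ∈ gen F S, ∃ t, y = n * xU j t) →
        ∃ n ∈ gen F S, ∃ t, xU i s * y = n * xU j t := by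
      rintro i hi s _ ⟨n, hn, t, rfl⟩
      rcases Finset.mem_insert.1 hi with rfl | hi
      · refine ⟨_, h.conj_mem hS hj s hn, s + t, ?_⟩
        rw [xU_add]
        group
      · exact ⟨_, mul_mem (xU_mem_gen hi s) hn, t, by rw [mul_assoc]⟩
    induction hu using Subgroup.closure_induction_left with
    | one => exact ⟨1, one_mem _, 0, by rw [xU_zero, one_mul]⟩
    | mul_left g hg y _ ih =>
      obtain ⟨i, hi, s, rfl⟩ := hg
      exact step i hi s y ih
    | inv_mul_cancel g hg y _ ih =>
      obtain ⟨i, hi, s, rfl⟩ := hg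
      rw [← xU_neg]
      exact step i hi _ y ih
  rw [← Nat.card_prod]
  refine Nat.card_le_card_of_surjective (fun p : gen F S × F =>
    (⟨p.1 * xU j p.2, mul_mem ?_ (xU_mem_gen (Finset.mem_insert_self _ _) _)⟩ :
      gen F (insert j S))) ?_
  · exact gen_le (fun i hi t => xU_mem_gen (Finset.mem_insert_of_mem hi) t) p.1.2
  · rintro ⟨u, hu⟩
    obtain ⟨n, hn, t, rfl⟩ := key u hu
    exact ⟨(⟨n, hn⟩, t), rfl⟩

theorem HX4_eq_gen : HX4 F = gen F (insert 4 indexH) := by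
  simp only [HX4, gen, Finset.mem_insert, or_comm]

theorem xU_mem_HX4 {i : ℕ} (hi : i ∈ insert 4 indexH) (t : F) : xU i t ∈ HX4 F := by
  rw [HX4_eq_gen]; exact xU_mem_gen hi t

/-- The seven remaining root subgroups are adjoined in an order in which each one normalizes the
group already generated: `X₇, X₁₁`, then `X₁, X₃, X₅, X₆`, then `X₂`. -/
theorem card_U_le [Finite F] : Nat.card (U F) ≤ Nat.card (HX4 F) * Nat.card F ^ 7 := by
  have h7 := card_gen_insert_le (F := F) (j := 7) (S := insert 4 indexH)
    (by decide) (by decide) (by decide)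
  have h11 := card_gen_insert_le (F := F) (j := 11) (S := insert 7 (insert 4 indexH))
    (by decide) (by decide) (by decide)
  have h1 := card_gen_insert_le (F := F) (j := 1) (S := insert 11 (insert 7 (insert 4 indexH)))
    (by decide) (by decide) (by decide)
  have h3 := card_gen_insert_le (F := F) (j := 3)
    (S := insert 1 (insert 11 (insert 7 (insert 4 indexH)))) (by decide) (by decide) (by decide)
  have h5 := card_gen_insert_le (F := F) (j := 5)
    (S := insert 3 (insert 1 (insert 11 (insert 7 (insert 4 indexH)))))
    (by decide) (by decide) (by decide)
  have h6 := card_gen_insert_le (F := F) (j := 6)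
    (S := insert 5 (insert 3 (insert 1 (insert 11 (insert 7 (insert 4 indexH))))))
    (by decide) (by decide) (by decide)
  have h2 := card_gen_insert_le (F := F) (j := 2)
    (S := insert 6 (insert 5 (insert 3 (insert 1 (insert 11 (insert 7 (insert 4 indexH)))))))
    (by decide) (by decide) (by decide)
  have e : insert 2 (insert 6 (insert 5 (insert 3 (insert 1 (insert 11 (insert 7
    (insert 4 indexH))))))) = Finset.Icc 1 21 := by decide
  rw [e, gen_Icc, Subgroup.card_top] at h2
  rw [HX4_eq_gen]
  calc _ ≤ _ := h2
    _ ≤ Nat.card (gen F (insert 4 indexH)) * Nat.card F * Nat.card F * Nat.card F * Nat.card F *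
        Nat.card F * Nat.card F * Nat.card F := by
      refine Nat.mul_le_mul_right _ (h6.trans (Nat.mul_le_mul_right _ (h5.trans
        (Nat.mul_le_mul_right _ (h3.trans (Nat.mul_le_mul_right _ (h1.trans
        (Nat.mul_le_mul_right _ (h11.trans (Nat.mul_le_mul_right _ h7))))))))))
    _ = _ := by ring

theorem index_HX4_le [Finite F] : (HX4 F).index ≤ Nat.card F ^ 7 := by
  have h := card_U_le (F := F)
  rw [← (HX4 F).card_mul_index] at h
  exact Nat.le_of_mul_le_mul_left h Nat.card_pos

/-! ### The elements `s₂(t)` -/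

theorem mul_mul_mul_of_commute {G : Type*} [Group G] {a b z a' b' z' w : G}
    (h : b * a' = w * (a' * b)) (ha : Commute z a') (hb : Commute z b') (hz : Commute w (z * z'))
    (wa : Commute w a') (wb : Commute w b) (wb' : Commute w b') :
    (a * b * z) * (a' * b' * z') = (a * a') * (b * b') * (z * z' * w) := by
  calc (a * b * z) * (a' * b' * z') = a * b * (z * (a' * b')) * z' := by simp only [mul_assoc]
    _ = a * (b * a') * b' * (z * z') := by
      rw [(ha.mul_right hb).eq]; simp only [mul_assoc]
    _ = a * (w * (a' * b * b')) * (z * z') := by rw [h]; simp only [mul_assoc]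
    _ = a * (a' * b * b') * (w * (z * z')) := by
      rw [((wa.mul_right wb).mul_right wb').eq]; simp only [mul_assoc]
    _ = _ := by rw [hz.eq]; simp only [mul_assoc]

theorem mul_mul_mul_comm_of_commute {G : Type*} [Group G] {x y z x' y' z' : G}
    (h1 : Commute y x') (h2 : Commute z x') (h3 : Commute z y') :
    (x * y * z) * (x' * y' * z') = (x * x') * (y * y') * (z * z') := by
  calc (x * y * z) * (x' * y' * z') = x * y * (z * (x' * y')) * z' := by simp only [mul_assoc]
    _ = x * (y * x') * y' * (z * z') := by
      rw [(h2.mul_right h3).eq]; simp only [mul_assoc]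
    _ = _ := by rw [h1.eq]; simp only [mul_assoc]

theorem commute_xU {i j : ℕ} (hi : i ∈ Finset.Icc 1 21) (hj : j ∈ Finset.Icc 1 21)
    (h : Comm i j) (t u : F) : Commute (xU i t) (xU j u) :=
  xU_commute hi hj h t u

theorem commute_xU7 : ∀ i ∈ ({1, 2, 3, 5, 6, 7, 11} : Finset ℕ), ∀ t u : F,
    Commute (xU 7 t) (xU i u) := fun i hi =>
  commute_xU (by decide) ((by decide : _ ⊆ Finset.Icc 1 21) hi)
    ((by decide : ∀ i ∈ ({1, 2, 3, 5, 6, 7, 11} : Finset ℕ), Comm 7 i) i hi)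

theorem commute_xU11 : ∀ i ∈ ({1, 2, 3, 5, 6, 7, 11} : Finset ℕ), ∀ t u : F,
    Commute (xU 11 t) (xU i u) := fun i hi =>
  commute_xU (by decide) ((by decide : _ ⊆ Finset.Icc 1 21) hi)
    ((by decide : ∀ i ∈ ({1, 2, 3, 5, 6, 7, 11} : Finset ℕ), Comm 11 i) i hi)

theorem commute_s1 {g : U F} (t r s : F) (h : ∀ i ∈ ({1, 2, 3, 5, 6, 7, 11} : Finset ℕ), ∀ u : F,
    Commute g (xU i u)) : Commute g (s1 t r s) := by
  unfold s1
  exact ((((((h 2 (by decide) _).mul_right (h 1 (by decide) _)).mul_right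
    (h 3 (by decide) _)).mul_right (h 5 (by decide) _)).mul_right (h 6 (by decide) _)).mul_right
    (h 7 (by decide) _)).mul_right (h 11 (by decide) _)

/-- The factors from `X₁, X₃, X₇`, those from `X₅, X₆, X₁₁`, and `X₂` commute with each other. In
the first two blocks a commutator contributes `tu` to the last coordinate, and `2(t+u)² = 2t² + 2u²
+ tu` in characteristic 3. So `s₂` is a one-parameter subgroup. -/
theorem s2_add [CharP F 3] (t u : F) : s2 (t + u) = s2 t * s2 u := by
  have h3 : (3 : F) = 0 := by exact_mod_cast CharP.cast_eq_zero F 3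
  have m31 : xU 3 (-t) * xU 1 u = xU 7 (t * u) * (xU 1 u * xU 3 (-t)) := by
    have := xU_mul (i := 3) (j := 1) (k := 7) (by decide) (by decide) (by decide) (by decide) (-t) u
    rw [this, show sgn (root 3) (root 1) = -1 by decide]
    congr 2
    push_cast; ring
  have m65 : xU 6 (-t) * xU 5 u = xU 11 (t * u) * (xU 5 u * xU 6 (-t)) := by
    have := xU_mul (i := 6) (j := 5) (k := 11) (by decide) (by decide) (by decide) (by decide)
      (-t) u
    rw [this, show sgn (root 6) (root 5) = -1 by decide]
    congr 2
    push_cast; ring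
  have e : 2 * (t + u) ^ 2 = 2 * t ^ 2 + 2 * u ^ 2 + t * u := by
    linear_combination t * u * h3
  have eA : (xU 1 t * xU 3 (-t) * xU 7 (2 * t ^ 2)) * (xU 1 u * xU 3 (-u) * xU 7 (2 * u ^ 2)) =
      xU 1 (t + u) * xU 3 (-(t + u)) * xU 7 (2 * (t + u) ^ 2) := by
    rw [e, neg_add, xU_add, xU_add, xU_add, xU_add]
    exact mul_mul_mul_of_commute m31 (commute_xU7 1 (by decide) _ _) (commute_xU7 3 (by decide) _ _)
      ((commute_xU7 7 (by decide) _ _).mul_right (commute_xU7 7 (by decide) _ _))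
      (commute_xU7 1 (by decide) _ _) (commute_xU7 3 (by decide) _ _)
      (commute_xU7 3 (by decide) _ _)
  have eB : (xU 5 t * xU 6 (-t) * xU 11 (2 * t ^ 2)) * (xU 5 u * xU 6 (-u) * xU 11 (2 * u ^ 2)) =
      xU 5 (t + u) * xU 6 (-(t + u)) * xU 11 (2 * (t + u) ^ 2) := by
    rw [e, neg_add, xU_add, xU_add, xU_add, xU_add]
    exact mul_mul_mul_of_commute m65 (commute_xU11 5 (by decide) _ _)
      (commute_xU11 6 (by decide) _ _)
      ((commute_xU11 11 (by decide) _ _).mul_right (commute_xU11 11 (by decide) _ _))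
      (commute_xU11 5 (by decide) _ _) (commute_xU11 6 (by decide) _ _)
      (commute_xU11 6 (by decide) _ _)
  have es : ∀ t : F, s2 t = xU 2 t * (xU 1 t * xU 3 (-t) * xU 7 (2 * t ^ 2)) *
      (xU 5 t * xU 6 (-t) * xU 11 (2 * t ^ 2)) := fun t => by
    have := ((commute_xU7 5 (by decide) (2 * t ^ 2) t).mul_right
      (commute_xU7 6 (by decide) (2 * t ^ 2) (-t))).eq
    simp only [s2, s1, mul_assoc] at this ⊢
    rw [← mul_assoc (xU 6 (-t)) (xU 7 _), ← mul_assoc (xU 5 t), ← this]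
    simp only [mul_assoc]
  have c2 : ∀ i ∈ ({1, 3, 5, 6, 7, 11} : Finset ℕ), ∀ t : F, Commute (xU i t) (xU 2 u) :=
    fun i hi t => commute_xU ((by decide : _ ⊆ Finset.Icc 1 21) hi) (by decide)
      ((by decide : ∀ i ∈ ({1, 3, 5, 6, 7, 11} : Finset ℕ), Comm i 2) i hi) t u
  have cA : ∀ i ∈ ({5, 6, 11} : Finset ℕ), ∀ t : F,
      Commute (xU i t) (xU 1 u * xU 3 (-u) * xU 7 (2 * u ^ 2)) := fun i hi t => by
    have c : ∀ j ∈ ({1, 3, 7} : Finset ℕ), ∀ u : F, Commute (xU i t) (xU j u) := fun j hj u =>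
      commute_xU ((by decide : _ ⊆ Finset.Icc 1 21) hi) ((by decide : _ ⊆ Finset.Icc 1 21) hj)
        ((by decide : ∀ i ∈ ({5, 6, 11} : Finset ℕ), ∀ j ∈ ({1, 3, 7} : Finset ℕ), Comm i j)
          i hi j hj) t u
    exact ((c 1 (by decide) _).mul_right (c 3 (by decide) _)).mul_right (c 7 (by decide) _)
  rw [es, es, es, ← eA, ← eB, xU_add]
  have k1 := ((c2 1 (by decide) t).mul_left (c2 3 (by decide) (-t))).mul_left
    (c2 7 (by decide) (2 * t ^ 2))
  have k2 := ((c2 5 (by decide) t).mul_left (c2 6 (by decide) (-t))).mul_left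
    (c2 11 (by decide) (2 * t ^ 2))
  have k3 := ((cA 5 (by decide) t).mul_left (cA 6 (by decide) (-t))).mul_left
    (cA 11 (by decide) (2 * t ^ 2))
  exact (mul_mul_mul_comm_of_commute k1 k2 k3).symm

theorem s2_zero : s2 (0 : F) = 1 := by
  simp [s2, s1, xU_zero]

theorem s2_neg [CharP F 3] (t : F) : s2 (-t) = (s2 t)⁻¹ := by
  rw [eq_inv_iff_mul_eq_one, ← s2_add, neg_add_cancel, s2_zero]

/-! ### The coordinate of `X₂` -/

theorem IsPosRoot.ne_zero {a : Lat} (ha : IsPosRoot a) : a ≠ 0 := by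
  rintro rfl
  simpa [ht] using ha.ht_pos

theorem x_apply {a : Lat} (ha : IsPosRoot a) (t : F) (y z : Wt) :
    ((x a t : UE F) : GL Wt F).val y z =
      (if y = z then 1 else 0) + if y.diff = z.diff + a then t * ((sgn a z.diff : ℤ) : F) else 0 := by
  rw [x_val ha, Matrix.add_apply, Matrix.one_apply, Matrix.smul_apply, rootVec, Matrix.of_apply,
    smul_eq_mul, mul_ite, mul_zero]

theorem UE_induction {p : UE F → Prop} (hx : ∀ a, IsPosRoot a → ∀ t : F, p (x a t))
    (h1 : p 1) (hm : ∀ u v, p u → p v → p (u * v)) (u : UE F) : p u := by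
  obtain ⟨g, hg⟩ := u
  have hgen : ∀ a (ha : IsPosRoot a) (t : F),
      (⟨rootElt F a t, Subgroup.subset_closure ⟨a, ha, t, rfl⟩⟩ : UE F) = x a t := fun a ha t => by
    rw [x, dif_pos ha]
  induction hg using Subgroup.closure_induction'' with
  | mem g hg =>
    obtain ⟨a, ha, t, rfl⟩ := hg
    rw [hgen a ha]
    exact hx a ha t
  | inv_mem g hg =>
    obtain ⟨a, ha, t, rfl⟩ := hg
    have : (⟨(rootElt F a t)⁻¹, inv_mem (Subgroup.subset_closure ⟨a, ha, t, rfl⟩)⟩ : UE F) =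
        x a (-t) := by
      rw [x_neg, ← hgen a ha]; rfl
    rw [this]
    exact hx a ha (-t)
  | one => exact h1
  | mul a b ha hb iha ihb => exact hm ⟨a, ha⟩ ⟨b, hb⟩ iha ihb

/-- Positive root elements only raise weights in the coordinatewise order, so `UE F` acts by
unitriangular matrices. -/
theorem UE_unitriangular (u : UE F) :
    (∀ y z, (u : GL Wt F).val y z ≠ 0 → z.diff ≤ y.diff) ∧ ∀ z, (u : GL Wt F).val z z = 1 := by
  refine UE_induction (p := fun u => (∀ y z, (u : GL Wt F).val y z ≠ 0 → z.diff ≤ y.diff) ∧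
    ∀ z, (u : GL Wt F).val z z = 1) (fun a ha t => ⟨fun y z h => ?_, fun z => ?_⟩)
    ⟨fun y z h => ?_, fun z => ?_⟩ (fun u v hu hv => ⟨fun y z h => ?_, fun z => ?_⟩) u
  · rw [x_apply ha] at h
    by_cases h1 : y = z
    · rw [h1]
    · by_cases h2 : y.diff = z.diff + a
      · rw [h2]; exact le_add_of_nonneg_right ha.2
      · simp [h1, h2] at h
  · rw [x_apply ha, if_pos rfl, if_neg (by simpa using ha.ne_zero), add_zero]
  · by_cases h1 : y = z
    · rw [h1]
    · simp [h1] at h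
  · simp
  · rw [Subgroup.coe_mul, Units.val_mul, Matrix.mul_apply] at h
    obtain ⟨w, -, hw⟩ := Finset.exists_ne_zero_of_sum_ne_zero h
    exact (hv.1 w z (right_ne_zero_of_mul hw)).trans (hu.1 y w (left_ne_zero_of_mul hw))
  · rw [Subgroup.coe_mul, Units.val_mul, Matrix.mul_apply, Finset.sum_eq_single z]
    · rw [hu.2, hv.2, one_mul]
    · intro w _ hne
      by_contra h
      exact hne (Wt.diff_injective (le_antisymm (hu.1 z w (left_ne_zero_of_mul h))
        (hv.1 w z (right_ne_zero_of_mul h))))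
    · simp

/-- The weight `ω₁ - α₁ - α₂ - α₃ - α₄`. -/
def lowWt : Wt := ⟨![1, 1, 1, 1, 0, 0], by decide⟩

/-- The weight `ω₁ - α₁ - α₃ - α₄`. -/
def highWt : Wt := ⟨![1, 0, 1, 1, 0, 0], by decide⟩

theorem highWt_diff : highWt.diff = lowWt.diff + root 2 := by decide

/-- The two weights differ by the simple root `α₂`, so nothing lies strictly between them. With
unitriangularity this makes the matrix entry between them additive, which yields the homomorphism
`coord₂`. -/
theorem eq_or_eq_of_le {w : Wt} (h1 : lowWt.diff ≤ w.diff) (h2 : w.diff ≤ highWt.diff) :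
    w = lowWt ∨ w = highWt := by
  have h : ∀ i, lowWt.diff i ≤ w.diff i ∧ w.diff i ≤ highWt.diff i := fun i => ⟨h1 i, h2 i⟩
  have a0 := h 0
  have a1 := h 1
  have a2 := h 2
  have a3 := h 3
  have a4 := h 4
  have a5 := h 5
  simp only [lowWt, highWt, Wt.diff] at a0 a1 a2 a3 a4 a5
  simp at a0 a1 a2 a3 a4 a5
  by_cases hw : w.diff 1 = 0
  · right
    apply Wt.diff_injective
    funext i
    fin_cases i <;> simp [highWt, Wt.diff] at hw ⊢ <;> omega
  · left
    apply Wt.diff_injective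
    funext i
    fin_cases i <;> simp [lowWt, Wt.diff] at hw ⊢ <;> omega

variable (F) in
/-- The homomorphism from `UE₆` to `(F, +)` that is trivial on all root subgroups but `X₂`. -/
def coord₂ : UE F →* Multiplicative F where
  toFun u := Multiplicative.ofAdd ((u : GL Wt F).val highWt lowWt)
  map_one' := by
    rw [Subgroup.coe_one, Units.val_one, Matrix.one_apply_ne (by decide)]; rfl
  map_mul' u v := by
    rw [← ofAdd_add, Subgroup.coe_mul, Units.val_mul, Matrix.mul_apply,
      Finset.sum_eq_add (a := lowWt) (b := highWt) (by decide)]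
    · rw [(UE_unitriangular u).2, (UE_unitriangular v).2, one_mul, mul_one]
    · intro w _ hw
      by_contra h
      rcases eq_or_eq_of_le ((UE_unitriangular v).1 w _ (right_ne_zero_of_mul h))
        ((UE_unitriangular u).1 _ w (left_ne_zero_of_mul h)) with h | h
      · exact hw.1 h
      · exact hw.2 h
    all_goals simp

theorem coord₂_x {a : Lat} (ha : IsPosRoot a) (t : F) :
    coord₂ F (x a t) =
      Multiplicative.ofAdd (if a = root 2 then t * ((sgn a lowWt.diff : ℤ) : F) else 0) := by
  change Multiplicative.ofAdd _ = _
  rw [x_apply ha, if_neg (by decide), zero_add, highWt_diff]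
  simp only [add_right_inj, eq_comm (a := root 2)]

variable (F) in
/-- The homomorphism from `U` to `(F, +)` that is trivial on all `X_i` with `i ≠ 2`. -/
def coordU : U F →* Multiplicative F :=
  QuotientGroup.lift (K5 F) (coord₂ F) (Subgroup.normalClosure_le_normal (by
    rintro _ ⟨a, ha, h, t, rfl⟩
    rw [SetLike.mem_coe, MonoidHom.mem_ker, coord₂_x ha, if_neg, ofAdd_zero]
    rintro rfl
    exact absurd h (by decide)))

theorem coordU_xU (i : ℕ) (hi : i ∈ (Finset.Icc 1 21).erase 2) (t : F) : coordU F (xU i t) = 1 := by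
  change coord₂ F (x (root i) t) = 1
  rw [coord₂_x (root_isPosRoot i (Finset.mem_of_mem_erase hi)), if_neg, ofAdd_zero]
  exact (by decide : ∀ i ∈ (Finset.Icc 1 21).erase 2, root i ≠ root 2) i hi

theorem coordU_s2 (t : F) (h : coordU F (s2 t) = 1) : t = 0 := by
  have h2 : coordU F (s2 t) = coordU F (xU 2 t) := by
    simp only [s2, s1, map_mul]
    rw [coordU_xU 1 (by decide), coordU_xU 3 (by decide), coordU_xU 5 (by decide),
      coordU_xU 6 (by decide), coordU_xU 7 (by decide), coordU_xU 11 (by decide)]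
    simp
  rw [h2] at h
  change coord₂ F (x (root 2) t) = 1 at h
  rw [coord₂_x (root_isPosRoot 2 (by decide)), if_pos rfl, ofAdd_eq_one] at h
  have hs : ((sgn (root 2) lowWt.diff : ℤ) : F) * ((sgn (root 2) lowWt.diff : ℤ) : F) = 1 := by
    rw [← Int.cast_mul, sgn_mul_self, Int.cast_one]
  rw [← mul_one t, ← hs, ← mul_assoc, h, zero_mul]

/-- The subgroup `H X₄` has index at least `3` in `H X₄ F₂`. -/
theorem three_mul_index_HX4F2_le [CharP F 3] [Finite F] {c : F} (hc : c ≠ 0) :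
    3 * (HX4F2 (c ^ 2)).index ≤ Nat.card F ^ 7 := by
  have h3 : (3 : F) = 0 := by exact_mod_cast CharP.cast_eq_zero F 3
  have hle : HX4 F ≤ HX4F2 (c ^ 2) := le_sup_left
  have hmem : ∀ d : F, d ^ 2 = c ^ 2 → s2 d ∈ HX4F2 (c ^ 2) := fun d hd =>
    (le_sup_right : _ ≤ HX4F2 (c ^ 2)) (Subgroup.subset_closure ⟨d, hd, rfl⟩)
  have hker : HX4 F ≤ (coordU F).ker := by
    rw [HX4_eq_gen]
    refine gen_le fun i hi t => ?_
    rw [MonoidHom.mem_ker]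
    exact coordU_xU i ((by decide : insert 4 indexH ⊆ (Finset.Icc 1 21).erase 2) hi) t
  have hne : ∀ d : F, d ≠ 0 → s2 d ∉ HX4 F := fun d hd h => hd (coordU_s2 d (hker h))
  have hrel : 3 ≤ (HX4 F).relIndex (HX4F2 (c ^ 2)) := by
    -- Quotients of two different elements among `1, s₂(c), s₂(-c)` are again `s₂(±c)`, because `3c
    -- = 0`. Their nonzero `X₂`-coordinate keeps them out of `HX4`, so the three cosets are
    -- distinct.
    let f : Fin 3 → HX4F2 (c ^ 2) := ![1, ⟨s2 c, hmem c rfl⟩, ⟨s2 (-c), hmem (-c) (by ring)⟩]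
    have hf : Function.Injective fun i => (QuotientGroup.mk (f i) :
        HX4F2 (c ^ 2) ⧸ (HX4 F).subgroupOf (HX4F2 (c ^ 2))) := by
      have e1 : s2 (-c) * s2 (-c) = s2 (c : F) := by
        rw [← s2_add]; congr 1; linear_combination -c * h3
      have e2 : s2 c * s2 c = s2 (-c : F) := by
        rw [← s2_add]; congr 1; linear_combination c * h3
      have n1 := hne c hc
      have n2 := hne (-c) (neg_ne_zero.2 hc)
      intro i j h
      rw [QuotientGroup.eq, Subgroup.mem_subgroupOf] at h
      have i1 := s2_neg c
      have i2 := s2_neg (-c)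
      rw [neg_neg] at i2
      fin_cases i <;> fin_cases j <;> simp [f, ← i1, ← i2, e1, e2, n1, n2] at h ⊢
    have := Nat.card_le_card_of_injective _ hf
    rwa [Nat.card_fin] at this
  calc 3 * (HX4F2 (c ^ 2)).index ≤ (HX4 F).relIndex (HX4F2 (c ^ 2)) * (HX4F2 (c ^ 2)).index :=
        Nat.mul_le_mul_right _ hrel
    _ = (HX4 F).index := Subgroup.relIndex_mul_index hle
    _ ≤ _ := index_HX4_le

/-! ### Representations and eigenvectors -/

section Rep

variable {G V : Type*} [Group G] [AddCommGroup V] [Module ℂ V]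

/-- The vector `v` is a common eigenvector of the elements of `K`, with eigenvalues `η`. -/
def HasChar (ρ : Representation ℂ G V) (K : Subgroup G) (η : K →* ℂˣ) (v : V) : Prop :=
  v ≠ 0 ∧ ∀ k : K, ρ k v = (η k : ℂ) • v

theorem smul_left_injective_of_ne_zero {v : V} (hv : v ≠ 0) {c d : ℂ} (h : c • v = d • v) :
    c = d :=
  smul_left_injective ℂ hv h

/-- The elements that preserve the line spanned by a vector form a subgroup. -/
def lineStab (ρ : Representation ℂ G V) (v : V) : Subgroup G where
  carrier := {g | ∃ c : ℂ, c ≠ 0 ∧ ρ g v = c • v}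
  one_mem' := ⟨1, one_ne_zero, by simp⟩
  mul_mem' := by
    rintro g h ⟨c, hc, e⟩ ⟨d, hd, f⟩
    exact ⟨d * c, mul_ne_zero hd hc, by rw [map_mul, Module.End.mul_apply, f, map_smul, e, smul_smul]⟩
  inv_mem' := by
    rintro g ⟨c, hc, e⟩
    refine ⟨c⁻¹, inv_ne_zero hc, ?_⟩
    have : v = c • ρ g⁻¹ v := by
      rw [← map_smul, ← e, ← Module.End.mul_apply, ← map_mul, inv_mul_cancel, map_one,
        Module.End.one_apply]
    nth_rw 2 [this]
    rw [smul_smul, inv_mul_cancel₀ hc, one_smul]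

theorem exists_hasChar (ρ : Representation ℂ G V) {v : V} (hv : v ≠ 0) (K : Subgroup G)
    (hK : K ≤ lineStab ρ v) : ∃ η : K →* ℂˣ, HasChar ρ K η v := by
  choose c hc e using fun k : K => hK k.2
  refine ⟨⟨⟨fun k => Units.mk0 (c k) (hc k), ?_⟩, ?_⟩, hv, fun k => e k⟩
  · ext
    refine smul_left_injective_of_ne_zero hv ?_
    rw [Units.val_mk0, ← e]
    simp
  · intro k l
    ext
    refine smul_left_injective_of_ne_zero hv ?_
    rw [Units.val_mul, Units.val_mk0, Units.val_mk0, Units.val_mk0, ← e, Subgroup.coe_mul, map_mul,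
      Module.End.mul_apply, e, map_smul, e, smul_smul, mul_comm]

theorem span_orbit_eq_top (ρ : Representation ℂ G V) [ρ.IsIrreducible] {v : V} (hv : v ≠ 0) :
    Submodule.span ℂ (Set.range fun g => ρ g v) = ⊤ := by
  let W : Subrepresentation ρ := ⟨Submodule.span ℂ (Set.range fun g => ρ g v), fun g w hw => by
    induction hw using Submodule.span_induction with
    | mem w hw =>
      obtain ⟨h, rfl⟩ := hw
      exact Submodule.subset_span ⟨g * h, by simp⟩
    | zero => simp
    | add a b _ _ ha hb => rw [map_add]; exact add_mem ha hb
    | smul c a _ ha => rw [map_smul]; exact Submodule.smul_mem _ _ ha⟩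
  rcases eq_bot_or_eq_top W with h | h
  · exfalso
    have h1 : v ∈ W.toSubmodule := Submodule.subset_span ⟨1, by simp⟩
    rw [h] at h1
    exact hv h1
  · exact congrArg Subrepresentation.toSubmodule h

theorem span_cosets_eq_top (ρ : Representation ℂ G V) [ρ.IsIrreducible] {K : Subgroup G}
    {η : K →* ℂˣ} {v : V} (hv : HasChar ρ K η v) :
    ⊤ ≤ Submodule.span ℂ (Set.range fun q : G ⧸ K => ρ q.out v) := by
  rw [← span_orbit_eq_top ρ hv.1, Submodule.span_le]
  rintro _ ⟨g, rfl⟩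
  obtain ⟨k, hk⟩ := QuotientGroup.mk_out_eq_mul K g
  have e : ρ g v = ((η k⁻¹ : ℂˣ) : ℂ) • ρ (QuotientGroup.mk g : G ⧸ K).out v := by
    rw [← map_smul, ← hv.2, ← Module.End.mul_apply, ← map_mul, hk]
    simp
  change ρ g v ∈ _
  rw [e]
  exact Submodule.smul_mem _ _ (Submodule.subset_span ⟨_, rfl⟩)

theorem finrank_le_index [Finite G] (ρ : Representation ℂ G V) [ρ.IsIrreducible]
    {K : Subgroup G} {η : K →* ℂˣ} {v : V} (hv : HasChar ρ K η v) :
    Module.finrank ℂ V ≤ K.index := by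
  classical
  have := Fintype.ofFinite (G ⧸ K)
  have h := finrank_range_le_card (R := ℂ) fun q : G ⧸ K => ρ q.out v
  rw [Set.finrank, eq_top_iff.2 (span_cosets_eq_top ρ hv), finrank_top] at h
  rwa [Subgroup.index, Nat.card_eq_fintype_card]

/-- An irreducible representation with a common eigenvector of the elements of `K` whose dimension
is the index of `K` is induced from `K`. -/
theorem character_eq_ind [Finite G] (ρ : Representation ℂ G V) [ρ.IsIrreducible] {K : Subgroup G}
    {η : K →* ℂˣ} {v : V} (hv : HasChar ρ K η v) (hd : K.index ≤ Module.finrank ℂ V) :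
    ρ.character = ind K η := by
  classical
  have := Fintype.ofFinite (G ⧸ K)
  have := Fintype.ofFinite G
  have := Fintype.ofFinite K
  have hcard : Fintype.card (G ⧸ K) = Module.finrank ℂ V := by
    rw [← Nat.card_eq_fintype_card]
    exact le_antisymm hd (finrank_le_index ρ hv)
  -- The translates of `v` by coset representatives span, and there are as many of them as the
  -- dimension. In this basis every group element acts by a monomial matrix, so its trace is the sum
  -- over the fixed cosets.
  let B := basisOfTopLeSpanOfCardEqFinrank _ (span_cosets_eq_top ρ hv) hcard
  have hB : ∀ q, B q = ρ q.out v := fun q => by simp [B]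
  funext g
  let f : G → ℂ := fun y => if h : y⁻¹ * g * y ∈ K then (η ⟨y⁻¹ * g * y, h⟩ : ℂ) else 0
  have hf : ∀ (y : G) (k : K), f (y * k) = f y := by
    intro y k
    have e : (y * k)⁻¹ * g * (y * k) = (k : G)⁻¹ * (y⁻¹ * g * y) * k := by group
    have hiff : (y * k)⁻¹ * g * (y * k) ∈ K ↔ y⁻¹ * g * y ∈ K := by
      rw [e, K.mul_mem_cancel_right k.2, K.mul_mem_cancel_left (K.inv_mem k.2)]
    simp only [f]
    by_cases h : y⁻¹ * g * y ∈ K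
    · rw [dif_pos h, dif_pos (hiff.2 h)]
      have : (⟨(y * k)⁻¹ * g * (y * k), hiff.2 h⟩ : K) = k⁻¹ * ⟨y⁻¹ * g * y, h⟩ * k :=
        Subtype.ext e
      rw [this, map_mul, map_mul, map_inv, mul_comm, mul_inv_cancel_left]
    · rw [dif_neg h, dif_neg (fun h' => h (hiff.1 h'))]
  have hdiag : ∀ q : G ⧸ K, B.repr (ρ g (B q)) q = f q.out := by
    intro q
    have e1 : ρ g (B q) = ρ (g * q.out) v := by rw [hB, map_mul, Module.End.mul_apply]
    obtain ⟨k, hk⟩ := QuotientGroup.mk_out_eq_mul K (g * q.out)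
    have e2 : ρ (g * q.out) v = ((η k⁻¹ : ℂˣ) : ℂ) • B (QuotientGroup.mk (g * q.out)) := by
      rw [hB, ← map_smul, ← hv.2, ← Module.End.mul_apply, ← map_mul, hk]
      simp
    rw [e1, e2, map_smul, Module.Basis.repr_self, Finsupp.smul_apply, Finsupp.single_apply]
    have hiff : (QuotientGroup.mk (g * q.out) : G ⧸ K) = q ↔ q.out⁻¹ * g * q.out ∈ K := by
      conv_lhs => rw [← QuotientGroup.out_eq' q, eq_comm, QuotientGroup.eq]
      simp [mul_assoc]
    simp only [f]
    by_cases h : q.out⁻¹ * g * q.out ∈ K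
    · rw [if_pos (hiff.2 h), dif_pos h, smul_eq_mul, mul_one]
      congr 2
      rw [hiff.2 h] at hk
      apply Subtype.ext
      change (k : G)⁻¹ = q.out⁻¹ * g * q.out
      rw [eq_comm, eq_inv_iff_mul_eq_one, mul_assoc, mul_assoc, ← mul_assoc g, ← hk, inv_mul_cancel]
    · rw [if_neg (fun h' => h (hiff.1 h')), dif_neg h, smul_zero]
  rw [Representation.character, LinearMap.trace_eq_matrix_trace ℂ B, Matrix.trace, ind]
  simp only [Matrix.diag_apply, LinearMap.toMatrix_apply, hdiag]
  rw [finsum_eq_sum_of_fintype]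
  change _ = _ * ∑ y, f y
  -- The summand is constant on each coset of `K`, so every coset contributes `|K|` equal terms,
  -- which cancels the normalizing factor.
  have hsum : ∑ y, f y = ∑ p : (G ⧸ K) × K, f p.1.out := by
    have hbij : Function.Bijective fun p : (G ⧸ K) × K => p.1.out * (p.2 : G) := by
      refine ⟨fun p q h => ?_, fun y => ?_⟩
      · have h1 : p.1 = q.1 := by
          have := congrArg (QuotientGroup.mk : G → G ⧸ K) h
          simpa using this
        refine Prod.ext h1 (Subtype.ext ?_)
        simpa [h1] using h
      · obtain ⟨k, hk⟩ := QuotientGroup.mk_out_eq_mul K y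
        exact ⟨(QuotientGroup.mk y, k⁻¹), by simp [hk]⟩
    rw [← hbij.sum_comp]
    exact Finset.sum_congr rfl fun p _ => hf _ _
  rw [hsum, Fintype.sum_prod_type]
  simp only [Finset.sum_const, Finset.card_univ, nsmul_eq_mul]
  rw [← Finset.mul_sum, ← mul_assoc, Nat.card_eq_fintype_card, inv_mul_cancel₀, one_mul]
  exact_mod_cast Fintype.card_ne_zero

theorem exists_common_eigenvector [FiniteDimensional ℂ V] {ι : Type*} [Finite ι]
    (f : ι → Module.End ℂ V) (hf : ∀ i j, Commute (f i) (f j)) (W : Submodule ℂ V) (hW : W ≠ ⊥)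
    (hfW : ∀ i, ∀ w ∈ W, f i w ∈ W) : ∃ v ∈ W, v ≠ 0 ∧ ∀ i, ∃ c : ℂ, f i v = c • v := by
  classical
  have := Fintype.ofFinite ι
  -- Induction on the number of operators that already act as scalars; the eigenspaces of each new
  -- operator are stable under all others.
  suffices h : ∀ s : Finset ι, ∃ W' ≤ W, W' ≠ ⊥ ∧ (∀ i, ∀ w ∈ W', f i w ∈ W') ∧
      ∀ i ∈ s, ∃ c : ℂ, ∀ w ∈ W', f i w = c • w by
    obtain ⟨W', hle, hne, -, h⟩ := h Finset.univ
    obtain ⟨v, hv, hv0⟩ := Submodule.exists_mem_ne_zero_of_ne_bot hne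
    refine ⟨v, hle hv, hv0, fun i => ?_⟩
    obtain ⟨c, hc⟩ := h i (Finset.mem_univ i)
    exact ⟨c, hc v hv⟩
  intro s
  induction s using Finset.induction_on with
  | empty => exact ⟨W, le_rfl, hW, hfW, by simp⟩
  | insert i s _ ih =>
    obtain ⟨W', hle, hne, hst, h⟩ := ih
    have : Nontrivial W' := Submodule.nontrivial_iff_ne_bot.2 hne
    obtain ⟨c, hc⟩ := Module.End.exists_eigenvalue ((f i).restrict (hst i))
    obtain ⟨⟨v, hv⟩, hvc⟩ := hc.exists_hasEigenvector
    have hv0 : v ≠ 0 := fun h0 => hvc.2 (Subtype.ext h0)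
    have hfv : f i v = c • v := congrArg Subtype.val hvc.apply_eq_smul
    refine ⟨W' ⊓ Module.End.eigenspace (f i) c, inf_le_left.trans hle, ?_, ?_, ?_⟩
    · rw [Submodule.ne_bot_iff]
      exact ⟨v, ⟨hv, Module.End.mem_eigenspace_iff.2 hfv⟩, hv0⟩
    · rintro j w ⟨hw, hw'⟩
      refine ⟨hst j w hw, ?_⟩
      change w ∈ Module.End.eigenspace (f i) c at hw'
      change f j w ∈ Module.End.eigenspace (f i) c
      rw [Module.End.mem_eigenspace_iff] at hw' ⊢
      rw [← Module.End.mul_apply, (hf i j).eq, Module.End.mul_apply, hw', map_smul]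
    · intro j hj
      rcases Finset.mem_insert.1 hj with rfl | hj
      · exact ⟨c, fun w hw => Module.End.mem_eigenspace_iff.1 hw.2⟩
      · obtain ⟨d, hd⟩ := h j hj
        exact ⟨d, fun w hw => hd w hw.1⟩

/-- Common eigenvectors of a commuting family with pairwise different systems of eigenvalues are
linearly independent. -/
theorem card_le_finrank_of_eigenvectors [FiniteDimensional ℂ V] {ι κ : Type*} [Finite κ]
    (f : ι → Module.End ℂ V) (hf : ∀ i j, Commute (f i) (f j)) (μ : κ → ι → ℂ)
    (hμ : Function.Injective μ) (w : κ → V) (hw : ∀ k, w k ≠ 0)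
    (h : ∀ k i, f i (w k) = μ k i • w k) : Nat.card κ ≤ Module.finrank ℂ V := by
  have := Fintype.ofFinite κ
  have hind := Module.End.independent_iInf_maxGenEigenspace_of_forall_mapsTo f
    fun i j c => Module.End.mapsTo_maxGenEigenspace_of_comm (hf j i) c
  have hlin := (hind.comp hμ).linearIndependent _ (fun k => (Submodule.mem_iInf _).2 fun i =>
    Module.End.genEigenspace_le_maximal _ _ 1
      (Module.End.mem_eigenspace_iff.2 (h k i))) hw
  rw [Nat.card_eq_fintype_card]
  exact hlin.fintype_card_le_finrank

/-- If a character takes the value `χ(1) ψ(t)` at the image of `t` under a homomorphism from `F`,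
with `ψ` a linear character, then the image of `t` acts as the scalar `ψ(t)`. -/
theorem eq_smul_of_character_eq [FiniteDimensional ℂ V] {F : Type*} [AddCommGroup F] [Finite F]
    (ρ : Representation ℂ G V) (g : F → G) (hg : ∀ s t, g (s + t) = g s * g t) (ψ : AddChar F ℂ)
    (h : ∀ t, ρ.character (g t) = Module.finrank ℂ V * ψ t) (t : F) (v : V) :
    ρ (g t) v = ψ t • v := by
  have := Fintype.ofFinite F
  have hq : (Fintype.card F : ℂ) ≠ 0 := by exact_mod_cast Fintype.card_ne_zero
  have hψ : ∀ t, ψ t * ψ (-t) = 1 := fun t => by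
    rw [← AddChar.map_add_eq_mul, add_neg_cancel, AddChar.map_zero_eq_one]
  -- The projection onto the `ψ`-isotypic part. Its trace is the full dimension, so the idempotent
  -- `1 - P` has trace zero and vanishes.
  let P : Module.End ℂ V := (Fintype.card F : ℂ)⁻¹ • ∑ s, ψ (-s) • ρ (g s)
  have hP : ∀ t, ρ (g t) * P = ψ t • P := by
    intro t
    simp only [P, mul_smul_comm, Finset.mul_sum, Finset.smul_sum, smul_smul]
    rw [← Equiv.sum_comp (Equiv.addLeft t) fun s => (ψ t * ((Fintype.card F : ℂ)⁻¹ * ψ (-s))) •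
      ρ (g s)]
    refine Finset.sum_congr rfl fun s _ => ?_
    rw [Equiv.coe_addLeft, hg, map_mul, neg_add, AddChar.map_add_eq_mul]
    congr 1
    linear_combination -(Fintype.card F : ℂ)⁻¹ * ψ (-s) * hψ t
  have hidem : IsIdempotentElem P := by
    rw [IsIdempotentElem]
    nth_rw 1 [show P = (Fintype.card F : ℂ)⁻¹ • ∑ s, ψ (-s) • ρ (g s) from rfl]
    simp only [smul_mul_assoc, Finset.sum_mul, hP, smul_smul]
    simp only [mul_comm (ψ (-_)), hψ, one_smul, Finset.sum_const, Finset.card_univ,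
      ← Nat.cast_smul_eq_nsmul ℂ]
    rw [smul_smul, inv_mul_cancel₀ hq, one_smul]
  have htr : LinearMap.trace ℂ V P = Module.finrank ℂ V := by
    simp only [P, map_smul, map_sum]
    have : ∀ s, LinearMap.trace ℂ V (ρ (g s)) = Module.finrank ℂ V * ψ s := h
    simp only [this, smul_eq_mul]
    have e : ∀ s, ψ (-s) * (Module.finrank ℂ V * ψ s) = Module.finrank ℂ V := fun s => by
      linear_combination (Module.finrank ℂ V : ℂ) * hψ s
    simp only [e, Finset.sum_const, Finset.card_univ, nsmul_eq_mul]
    rw [inv_mul_cancel_left₀ hq]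
  have h1 : P = 1 := by
    have := (LinearMap.IsIdempotentElem.trace_eq_zero_iff hidem.one_sub).1
      (by rw [map_sub, htr, LinearMap.trace_one, sub_self])
    exact (sub_eq_zero.1 this).symm
  have := hP t
  rw [h1, mul_one] at this
  rw [this]
  simp

end Rep

/-! ### The action of `U` on the linear characters of `H X₄` -/

/-- The index of the root `α_i + α_j`, for `i` in `indexH` or equal to `4`, and for `j` the index
of a root subgroup outside `H X₄`; it is `0` if `α_i + α_j` is not a root of height at most `4`. -/
def sumIndex : ℕ → ℕ → ℕ
  | 1, 9 => 12
  | 1, 13 => 17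
  | 1, 15 => 18
  | 2, 4 => 8
  | 2, 9 => 13
  | 2, 10 => 14
  | 2, 12 => 17
  | 2, 15 => 19
  | 2, 16 => 20
  | 3, 4 => 9
  | 3, 8 => 13
  | 3, 10 => 15
  | 3, 14 => 19
  | 3, 16 => 21
  | 5, 4 => 10
  | 5, 8 => 14
  | 5, 9 => 15
  | 5, 12 => 18
  | 5, 13 => 19
  | 6, 10 => 16
  | 6, 14 => 20
  | 6, 15 => 21
  | 7, 4 => 12
  | 7, 8 => 17
  | 7, 10 => 18
  | 11, 4 => 16
  | 11, 8 => 20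
  | 11, 9 => 21
  | _, _ => 0

/-- The sign `sgn α_i α_j` if `α_i + α_j` is a root, which only depends on `j`. -/
def sumSign : ℕ → ℤ
  | 5 => 1
  | 6 => 1
  | 11 => 1
  | _ => -1

/-- The indices of the root subgroups of the complement of `H X₄`. -/
def indexL : Finset ℕ := {1, 2, 3, 5, 6, 7, 11}

theorem sumIndex_spec : ∀ j ∈ indexL, ∀ i ∈ insert 4 indexH,
    (sumIndex j i = 0 ∧ Comm i j) ∨ (sumIndex j i ≠ 0 ∧ sumIndex j i ∈ insert 4 indexH ∧
      ip (root i) (root j) = -1 ∧ root (sumIndex j i) = root i + root j ∧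
      sgn (root i) (root j) = sumSign j) := by
  decide

theorem indexL_subset : indexL ⊆ Finset.Icc 1 21 := by decide

theorem indexA_subset : insert 4 indexH ⊆ Finset.Icc 1 21 := by decide

theorem comm_indexA : ∀ i ∈ insert 4 indexH, ∀ j ∈ insert 4 indexH, Comm i j := by decide

/-- The action of `x_j(s)` on the parameters of linear characters of `H X₄`. -/
def move (j : ℕ) (s : F) (b : ℕ → F) : ℕ → F := fun i =>
  if sumIndex j i = 0 then b i else b i + sumSign j * s * b (sumIndex j i)

section Eigen

variable {V : Type*} [AddCommGroup V] [Module ℂ V]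

/-- The vector `v` is an eigenvector of all `x_i(t)` in `H X₄`, with eigenvalue `φ(b_i t)`. -/
def IsEig (φ : AddChar F ℂ) (ρ : Representation ℂ (U F) V) (b : ℕ → F) (v : V) : Prop :=
  v ≠ 0 ∧ ∀ i ∈ insert 4 indexH, ∀ t, ρ (xU i t) v = φ (b i * t) • v

variable {φ : AddChar F ℂ} {ρ : Representation ℂ (U F) V} {b b' : ℕ → F} {v : V}

theorem rho_ne_zero (ρ : Representation ℂ (U F) V) (g : U F) (hv : v ≠ 0) : ρ g v ≠ 0 := by
  intro h
  apply hv
  have : ρ g⁻¹ (ρ g v) = v := by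
    rw [← Module.End.mul_apply, ← map_mul, inv_mul_cancel, map_one, Module.End.one_apply]
  rw [← this, h, map_zero]

theorem IsEig.congr (h : IsEig φ ρ b v) (hb : ∀ i ∈ insert 4 indexH, b' i = b i) :
    IsEig φ ρ b' v :=
  ⟨h.1, fun i hi t => by rw [hb i hi, h.2 i hi]⟩

theorem IsEig.move (h : IsEig φ ρ b v) {j : ℕ} (hj : j ∈ indexL) (s : F) :
    IsEig φ ρ (move j s b) (ρ (xU j s) v) := by
  refine ⟨rho_ne_zero ρ _ h.1, fun i hi t => ?_⟩
  rw [E6Sylow.move, ← Module.End.mul_apply, ← map_mul]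
  rcases sumIndex_spec j hj i hi with ⟨h0, hc⟩ | ⟨h0, hk, hip, hr, hs⟩
  · rw [if_pos h0, xU_commute (indexA_subset hi) (indexL_subset hj) hc, map_mul,
      Module.End.mul_apply, h.2 i hi, map_smul]
  · have hip' : ip (root (sumIndex j i)) (root j) = 1 := by
      have h2 : ip (root j) (root j) = 2 := (root_isPosRoot j (indexL_subset hj)).1
      rw [hr, ip_add_left, hip, h2]; norm_num
    rw [if_neg h0, xU_mul (indexA_subset hi) (indexL_subset hj) hip hr, ← mul_assoc,
      xU_commute (indexA_subset hk) (indexL_subset hj) (Or.inl (by rw [hip']; norm_num)), map_mul,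
      map_mul, Module.End.mul_apply, Module.End.mul_apply, h.2 i hi, map_smul, h.2 _ hk, map_smul,
      map_smul, smul_smul, ← AddChar.map_add_eq_mul, hs]
    congr 2
    ring

/-- The composite of the moves that belong to the factors of `s₁(t, r, s)`. -/
def moveS1 (t r s : F) (b : ℕ → F) : ℕ → F :=
  move 2 t (move 1 t (move 3 (-t) (move 5 t (move 6 (-t) (move 7 r (move 11 s b))))))

/-- The composite of four moves by simple root elements. -/
def moveSimple (p : Fin 4 → F) (b : ℕ → F) : ℕ → F :=
  move 1 (p 0) (move 3 (p 1) (move 5 (p 2) (move 6 (p 3) b)))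

theorem IsEig.moveS1 (h : IsEig φ ρ b v) (t r s : F) :
    IsEig φ ρ (moveS1 t r s b) (ρ (s1 t r s) v) := by
  simp only [s1, map_mul, Module.End.mul_apply]
  exact ((((((h.move (by decide) s).move (by decide) r).move (by decide) (-t)).move (by decide)
    t).move (by decide) (-t)).move (by decide) t).move (by decide) t

theorem IsEig.moveSimple (h : IsEig φ ρ b v) (p : Fin 4 → F) :
    IsEig φ ρ (moveSimple p b) (ρ (xU 1 (p 0) * xU 3 (p 1) * xU 5 (p 2) * xU 6 (p 3)) v) := by
  simp only [map_mul, Module.End.mul_apply]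
  exact (((h.move (by decide) _).move (by decide) _).move (by decide) _).move (by decide) _

end Eigen

/-- The parameters of the characters whose restrictions to the root subgroups of height `4` are
`φ`. -/
def IsNormalized (b : ℕ → F) : Prop := ∀ i ∈ Finset.Icc 17 21, b i = 1

theorem IsNormalized.eq {b : ℕ → F} (h : IsNormalized b) :
    b 17 = 1 ∧ b 18 = 1 ∧ b 19 = 1 ∧ b 20 = 1 ∧ b 21 = 1 :=
  ⟨h 17 (by decide), h 18 (by decide), h 19 (by decide), h 20 (by decide), h 21 (by decide)⟩

theorem forall_indexA {p : ℕ → Prop} : (∀ i ∈ insert 4 indexH, p i) ↔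
    p 4 ∧ (p 8 ∧ p 9 ∧ p 10) ∧ (p 12 ∧ p 13 ∧ p 14 ∧ p 15 ∧ p 16) ∧
      (p 17 ∧ p 18 ∧ p 19 ∧ p 20 ∧ p 21) := by
  have : insert 4 indexH = ({4, 8, 9, 10, 12, 13, 14, 15, 16, 17, 18, 19, 20, 21} : Finset ℕ) := by
    decide
  rw [this]
  simp only [Finset.mem_insert, Finset.mem_singleton, forall_eq_or_imp, forall_eq, and_assoc]

/-! ### Orbits -/

theorem moveSimple_normalized {b : ℕ → F} (hb : IsNormalized b) (p : Fin 4 → F) :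
    IsNormalized (moveSimple p b) := by
  intro i hi
  have h := hb i hi
  fin_cases hi <;> simpa [moveSimple, move, sumIndex] using h

theorem moveS1_normalized {b : ℕ → F} (hb : IsNormalized b) (t r s : F) :
    IsNormalized (moveS1 t r s b) := by
  intro i hi
  have h := hb i hi
  fin_cases hi <;> simpa [moveS1, move, sumIndex] using h

theorem moveSimple_apply {b : ℕ → F} (hb : IsNormalized b) (p : Fin 4 → F) :
    moveSimple p b 12 = b 12 + p 2 ∧ moveSimple p b 13 = b 13 - p 0 + p 2 ∧
      moveSimple p b 14 = b 14 - p 1 + p 3 ∧ moveSimple p b 15 = b 15 - p 0 + p 3 ∧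
      moveSimple p b 16 = b 16 - p 1 := by
  obtain ⟨h1, h2, h3, h4, h5⟩ := hb.eq
  simp only [moveSimple, move, sumIndex, sumSign, h1, h2, h3, h4, h5]
  refine ⟨?_, ?_, ?_, ?_, ?_⟩ <;> simp <;> ring

/-- The parameters `b₁₂, b₁₃, b₁₄, b₁₆` already recover the four translations. Once these agree, the
moves can be undone on `b₈, b₉, b₁₀` and then on `b₄`. -/
theorem moveSimple_injective {b b' : ℕ → F} (hb : IsNormalized b) (hb' : IsNormalized b')
    (h3 : ∀ i ∈ Finset.Icc 12 16, b i = b' i) (p p' : Fin 4 → F)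
    (h : ∀ i ∈ insert 4 indexH, moveSimple p b i = moveSimple p' b' i) :
    p = p' ∧ b 4 = b' 4 ∧ b 8 = b' 8 ∧ b 9 = b' 9 ∧ b 10 = b' 10 := by
  obtain ⟨e12, e13, e14, e15, e16⟩ := moveSimple_apply hb p
  obtain ⟨f12, f13, f14, f15, f16⟩ := moveSimple_apply hb' p'
  obtain ⟨g4, ⟨g8, g9, g10⟩, ⟨g12, g13, g14, g15, g16⟩, -⟩ := forall_indexA.1 h
  have b12 := h3 12 (by decide)
  have b13 := h3 13 (by decide)
  have b14 := h3 14 (by decide)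
  have b15 := h3 15 (by decide)
  have b16 := h3 16 (by decide)
  rw [e12, f12] at g12
  rw [e13, f13] at g13
  rw [e14, f14] at g14
  rw [e16, f16] at g16
  have p2 : p 2 = p' 2 := by linear_combination g12 - b12
  have p0 : p 0 = p' 0 := by linear_combination p2 + b13 - g13
  have p1 : p 1 = p' 1 := by linear_combination b16 - g16
  have p3 : p 3 = p' 3 := by linear_combination g14 - b14 + p1
  have hp : p = p' := by
    funext i
    fin_cases i <;> assumption
  subst hp
  obtain ⟨h1, h2, h3, h4, h5⟩ := hb.eq
  obtain ⟨k1, k2, k3, k4, k5⟩ := hb'.eq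
  simp [moveSimple, move, sumIndex, sumSign, h2, h3, h4, h5, k2, k3, k4, k5, b12, b13, b14, b15,
    b16] at g4 g8 g9 g10
  refine ⟨rfl, ?_, g8, g9, g10⟩
  rw [g9, g10] at g4
  linear_combination g4

/-- The four translations span the kernel of the linear form `B3`. The witness is solved from the
coordinates 12, 13, 14 and 16; coordinate 15 is then forced by the equality of the invariants. -/
theorem exists_moveSimple {b b' : ℕ → F} (hb : IsNormalized b) (h : B3 b = B3 b') :
    ∃ p, ∀ i ∈ Finset.Icc 12 16, moveSimple p b i = b' i := by
  refine ⟨![b' 12 - b 12 - b' 13 + b 13, b 16 - b' 16, b' 12 - b 12,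
    b' 14 - b 14 + b 16 - b' 16], fun i hi => ?_⟩
  obtain ⟨e12, e13, e14, e15, e16⟩ := moveSimple_apply hb ![b' 12 - b 12 - b' 13 + b 13,
    b 16 - b' 16, b' 12 - b 12, b' 14 - b 14 + b 16 - b' 16]
  simp only [B3] at h
  fin_cases hi
  · rw [e12]; simp
  · rw [e13]; simp
  · rw [e14]; simp; ring
  · rw [e15]; simp; linear_combination h
  · rw [e16]; simp

/-- The pattern of signs in `s₁` makes the contributions to the parameters of height 3 cancel in
pairs, except for index 15, which receives `-3t`. This is where characteristic 3 creates the extra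
stabilizer. -/
theorem moveS1_eq_self [CharP F 3] {b : ℕ → F} (hb : IsNormalized b) (t r s : F) :
    ∀ i ∈ Finset.Icc 12 16, moveS1 t r s b i = b i := by
  intro i hi
  have h3 : (3 : F) = 0 := by exact_mod_cast CharP.cast_eq_zero F 3
  obtain ⟨h1, h2, h3', h4, h5⟩ := hb.eq
  fin_cases hi <;> simp [moveS1, move, sumIndex, sumSign, h1, h2, h3', h4, h5]
  linear_combination -t * h3

theorem moveS1_apply [CharP F 3] {b : ℕ → F} (hb : IsNormalized b) (t r s : F) :
    moveS1 t r s b 8 = b 8 + t * (b 13 + b 14) - r + s ∧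
      moveS1 t r s b 9 = b 9 + t * (b 15 - b 12 - b 13) + s + t ^ 2 ∧
      moveS1 t r s b 10 = b 10 + t * (b 15 - b 14 - b 16) - r - t ^ 2 ∧
      moveS1 t r s b 4 = b 4 + t * (b 10 + b 9 - b 8) - r * b 12 + s * b 16
        - t ^ 2 * (b 13 + b 14 - b 15 + b 16) - t ^ 3 := by
  have h3 : (3 : F) = 0 := by exact_mod_cast CharP.cast_eq_zero F 3
  obtain ⟨h1, h2, h3', h4, h5⟩ := hb.eq
  simp only [moveS1, move, sumIndex, sumSign, h1, h2, h3', h4, h5]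
  refine ⟨?_, ?_, ?_, ?_⟩
  · simp; ring
  · simp; linear_combination -t ^ 2 * h3
  · simp; ring
  · simp; ring

theorem exists_moveS1 [CharP F 3] {b b' : ℕ → F} (hb : IsNormalized b)
    (h : ∀ i ∈ Finset.Icc 12 16, b i = b' i) (hB : B3 b ≠ 0) :
    ∃ t r s, ∀ i ∈ Finset.Icc 8 10 ∪ Finset.Icc 12 16, moveS1 t r s b i = b' i := by
  have h3 : (3 : F) = 0 := by exact_mod_cast CharP.cast_eq_zero F 3
  -- Acting by `s₁(t, r, s)` changes `B2` by `-t * B3 b`. This determines `t`; then `s` and `r`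
  -- correct the parameters 9 and 10, and parameter 8 follows from `B2`.
  obtain ⟨t, ht⟩ : ∃ t, t * B3 b = B2 b - B2 b' := ⟨_, div_mul_cancel₀ _ hB⟩
  let s := b' 9 - (b 9 + t * (b 15 - b 12 - b 13) + t ^ 2)
  let r := b 10 + t * (b 15 - b 14 - b 16) - t ^ 2 - b' 10
  refine ⟨t, r, s, fun i hi => ?_⟩
  obtain ⟨e8, e9, e10, -⟩ := moveS1_apply hb t r s
  simp only [B3, B2] at ht
  rcases Finset.mem_union.1 hi with hi | hi
  · fin_cases hi
    · simp only [e8, r, s]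
      linear_combination ht + t * (b 13 + b 14 - b 15) * h3
    · simp only [e9, s]; ring
    · simp only [e10, r]; ring
  · rw [moveS1_eq_self hb t r s i hi, h i hi]

theorem exists_moveS1_zero [CharP F 3] {b b' : ℕ → F} (hb : IsNormalized b)
    (h : TrivialOnH3 b) (h' : TrivialOnH3 b') (hB : B2 b = B2 b') :
    ∃ r s, (∀ i ∈ Finset.Icc 8 10 ∪ Finset.Icc 12 16, moveS1 0 r s b i = b' i) ∧
      moveS1 0 r s b 4 = b 4 := by
  refine ⟨b 10 - b' 10, b' 9 - b 9, fun i hi => ?_, ?_⟩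
  all_goals obtain ⟨e8, e9, e10, e4⟩ := moveS1_apply hb 0 (b 10 - b' 10) (b' 9 - b 9)
  · simp only [B2] at hB
    rcases Finset.mem_union.1 hi with hi | hi
    · fin_cases hi
      · rw [e8]; linear_combination -hB
      · rw [e9]; ring
      · rw [e10]; ring
    · rw [moveS1_eq_self hb _ _ _ i hi, h i hi, h' i hi]
  · rw [e4, h 12 (by decide), h 16 (by decide)]; ring

/-- The values `r = s = 2t² = -t²` are exactly those that cancel the quadratic terms `±t²` in the
parameters 9 and 10. Only the parameter of `X₄` still moves. -/
theorem moveS2_apply [CharP F 3] {b : ℕ → F} (hb : IsNormalized b) (h : TrivialOnH3 b) (t : F) :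
    (∀ i ∈ indexH, moveS1 t (2 * t ^ 2) (2 * t ^ 2) b i = b i) ∧
      moveS1 t (2 * t ^ 2) (2 * t ^ 2) b 4 = b 4 - (t ^ 3 - B2 b * t) := by
  have h3 : (3 : F) = 0 := by exact_mod_cast CharP.cast_eq_zero F 3
  obtain ⟨e8, e9, e10, e4⟩ := moveS1_apply hb t (2 * t ^ 2) (2 * t ^ 2)
  have b12 := h 12 (by decide)
  have b13 := h 13 (by decide)
  have b14 := h 14 (by decide)
  have b15 := h 15 (by decide)
  have b16 := h 16 (by decide)
  simp only [b12, b13, b14, b15, b16] at e8 e9 e10 e4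
  refine ⟨fun i hi => ?_, by rw [e4, B2]; ring⟩
  have hi' : i ∈ Finset.Icc 8 10 ∪ Finset.Icc 12 16 ∪ Finset.Icc 17 21 :=
    (by decide : indexH ⊆ Finset.Icc 8 10 ∪ Finset.Icc 12 16 ∪ Finset.Icc 17 21) hi
  rcases Finset.mem_union.1 hi' with hi | hi
  · rcases Finset.mem_union.1 hi with hi | hi
    · fin_cases hi
      · rw [e8]; ring
      · rw [e9]; linear_combination t ^ 2 * h3
      · rw [e10]; linear_combination -t ^ 2 * h3
    · exact moveS1_eq_self hb _ _ _ i hi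
  · rw [moveS1_normalized hb _ _ _ i hi, hb i hi]

/-! ### Regular orbits and the lower bound `q⁷` for the degree -/

theorem mulShift_injective [Finite F] {φ : AddChar F ℂ} (hφ : φ ≠ 1) {a b : F}
    (h : ∀ t, φ (a * t) = φ (b * t)) : a = b :=
  AddChar.to_mulShift_inj_of_isPrimitive (AddChar.IsPrimitive.of_ne_one hφ)
    (DFunLike.ext _ _ fun t => by simpa [AddChar.mulShift_apply] using h t)

/-- A representation in which the orbit of a linear character of `H X₄` is regular has dimension at
least `q⁷`. -/
theorem pow_seven_le_finrank [CharP F 3] [Finite F] {V : Type*} [AddCommGroup V] [Module ℂ V]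
    [FiniteDimensional ℂ V] {φ : AddChar F ℂ} (hφ : φ ≠ 1) {ρ : Representation ℂ (U F) V}
    {b : ℕ → F} {v : V} (hv : IsEig φ ρ b v) (hb : IsNormalized b)
    (hinj : ∀ t r s t' r' s' : F, (∀ i ∈ ({4, 8, 9, 10} : Finset ℕ),
      moveS1 t r s b i = moveS1 t' r' s' b i) → t = t' ∧ r = r' ∧ s = s') :
    Nat.card F ^ 7 ≤ Module.finrank ℂ V := by
  let c : (Fin 4 → F) × F × F × F → ℕ → F := fun k =>
    moveSimple k.1 (moveS1 k.2.1 k.2.2.1 k.2.2.2 b)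
  have h := card_le_finrank_of_eigenvectors (κ := (Fin 4 → F) × F × F × F)
    (fun i : {i // i ∈ insert 4 indexH} × F => ρ (xU i.1 i.2))
    (fun i j => by
      rw [Commute, SemiconjBy, ← map_mul, ← map_mul, xU_commute (indexA_subset i.1.2)
        (indexA_subset j.1.2) (comm_indexA _ i.1.2 _ j.1.2)])
    (fun k i => φ (c k i.1 * i.2)) ?_ (fun k => _)
    (fun k => ((hv.moveS1 k.2.1 k.2.2.1 k.2.2.2).moveSimple k.1).1)
    (fun k i => ((hv.moveS1 k.2.1 k.2.2.1 k.2.2.2).moveSimple k.1).2 i.1 i.1.2 i.2)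
  · refine le_trans (le_of_eq ?_) h
    simp only [Nat.card_prod, Nat.card_fun, Nat.card_fin]
    ring
  · rintro ⟨p, t, r, s⟩ ⟨p', t', r', s'⟩ h
    have hc : ∀ i ∈ insert 4 indexH, c (p, t, r, s) i = c (p', t', r', s') i := fun i hi =>
      mulShift_injective hφ fun u => congrFun h (⟨i, hi⟩, u)
    obtain ⟨rfl, h4, h8, h9, h10⟩ := moveSimple_injective (moveS1_normalized hb t r s)
      (moveS1_normalized hb t' r' s')
      (fun i hi => by rw [moveS1_eq_self hb _ _ _ i hi, moveS1_eq_self hb _ _ _ i hi]) _ _ hc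
    obtain ⟨rfl, rfl, rfl⟩ := hinj t r s t' r' s' (by
      simp only [Finset.mem_insert, Finset.mem_singleton]
      rintro i (rfl | rfl | rfl | rfl) <;> assumption)
    rfl

theorem moveS1_injective_of_B3 [CharP F 3] {b : ℕ → F} (hb : IsNormalized b) (hB : B3 b ≠ 0)
    (t r s t' r' s' : F) (h : ∀ i ∈ ({4, 8, 9, 10} : Finset ℕ),
      moveS1 t r s b i = moveS1 t' r' s' b i) : t = t' ∧ r = r' ∧ s = s' := by
  have h3 : (3 : F) = 0 := by exact_mod_cast CharP.cast_eq_zero F 3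
  obtain ⟨e8, e9, e10, -⟩ := moveS1_apply hb t r s
  obtain ⟨f8, f9, f10, -⟩ := moveS1_apply hb t' r' s'
  have g8 := h 8 (by decide)
  have g9 := h 9 (by decide)
  have g10 := h 10 (by decide)
  rw [e8, f8] at g8
  rw [e9, f9] at g9
  rw [e10, f10] at g10
  have ht : t = t' := by
    refine mul_right_cancel₀ hB ?_
    rw [B3]
    linear_combination g8 - g9 - g10 - (t - t') * (b 13 + b 14 - b 15) * h3
  subst ht
  exact ⟨rfl, by linear_combination -g10, by linear_combination g9⟩

/-- By additivity of cubing, `(t - t')³ = B (t - t')`, so a nonzero difference would be a square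
root of `B`. -/
theorem eq_of_cube_sub_eq [CharP F 3] {B : F} (hB : ¬ IsNonzeroSquare B) {t t' : F}
    (h : t ^ 3 - B * t = t' ^ 3 - B * t') : t = t' := by
  have h3 : (3 : F) = 0 := by exact_mod_cast CharP.cast_eq_zero F 3
  by_contra hne
  refine hB ⟨t - t', sub_ne_zero.2 hne, ?_⟩
  refine mul_right_cancel₀ (sub_ne_zero.2 hne) ?_
  linear_combination -h + (t ^ 2 * t' - t * t' ^ 2) * h3

theorem moveS1_injective_of_B2 [CharP F 3] {b : ℕ → F} (hb : IsNormalized b)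
    (h0 : TrivialOnH3 b) (hB : ¬ IsNonzeroSquare (B2 b))
    (t r s t' r' s' : F) (h : ∀ i ∈ ({4, 8, 9, 10} : Finset ℕ),
      moveS1 t r s b i = moveS1 t' r' s' b i) : t = t' ∧ r = r' ∧ s = s' := by
  obtain ⟨e8, e9, e10, e4⟩ := moveS1_apply hb t r s
  obtain ⟨f8, f9, f10, f4⟩ := moveS1_apply hb t' r' s'
  have g4 := h 4 (by decide)
  have g9 := h 9 (by decide)
  have g10 := h 10 (by decide)
  rw [e4, f4] at g4
  rw [e9, f9] at g9
  rw [e10, f10] at g10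
  have b12 := h0 12 (by decide)
  have b13 := h0 13 (by decide)
  have b14 := h0 14 (by decide)
  have b15 := h0 15 (by decide)
  have b16 := h0 16 (by decide)
  simp only [b12, b13, b14, b15, b16] at g4 g9 g10
  have ht : t = t' := eq_of_cube_sub_eq hB (by rw [B2]; linear_combination -g4)
  subst ht
  exact ⟨rfl, by linear_combination -g10, by linear_combination g9⟩

/-! ### Change of group -/

/-- The subrepresentations of a representation and of its pull-back along a surjection agree. -/
def subrepresentationOrderIso {G H V : Type*} [Group G] [Group H] [AddCommGroup V] [Module ℂ V]
    (ρ : Representation ℂ G V) (σ : Representation ℂ H V) (f : G → H) (hf : Function.Surjective f)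
    (h : ∀ g, ρ g = σ (f g)) : Subrepresentation ρ ≃o Subrepresentation σ where
  toFun W := ⟨W.toSubmodule, fun x v hv => by
    obtain ⟨g, rfl⟩ := hf x
    rw [← h]
    exact W.apply_mem_toSubmodule g hv⟩
  invFun W := ⟨W.toSubmodule, fun g v hv => by
    rw [h]
    exact W.apply_mem_toSubmodule _ hv⟩
  left_inv _ := rfl
  right_inv _ := rfl
  map_rel_iff' := Iff.rfl

theorem isIrreducible_iff_of_surjective {G H V : Type*} [Group G] [Group H] [AddCommGroup V]
    [Module ℂ V] (ρ : Representation ℂ G V) (σ : Representation ℂ H V) (f : G → H)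
    (hf : Function.Surjective f) (h : ∀ g, ρ g = σ (f g)) :
    ρ.IsIrreducible ↔ σ.IsIrreducible :=
  OrderIso.isSimpleOrder_iff (subrepresentationOrderIso ρ σ f hf h)

/-! ### The action of the torus -/

/-- Conjugation by the inverse of an element of the torus. -/
def torusConjHom (t : torus F) : UE F →* UE F where
  toFun u := ⟨(t : GL Wt F)⁻¹ * u * t, by
    have h := torus_conj_mem (inv_mem t.2) u.2
    rwa [inv_inv] at h⟩
  map_one' := by ext1; simp
  map_mul' u v := by ext1; simp [mul_assoc]

theorem torusConjHom_surjective (t : torus F) : Function.Surjective (torusConjHom t) := fun u =>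
  ⟨⟨t * u * (t : GL Wt F)⁻¹, torus_conj_mem t.2 u.2⟩, by ext1; simp [torusConjHom, mul_assoc]⟩

theorem torusConj_eq (t : torus F) (χ : UE F → ℂ) : torusConj t χ = χ ∘ torusConjHom t := rfl

theorem isIrrChar_torusConj (t : torus F) {χ : UE F → ℂ} (h : IsIrrChar χ) :
    IsIrrChar (torusConj t χ) := by
  obtain ⟨n, ρ, hρ, rfl⟩ := h
  let σ : Representation ℂ (UE F) (Fin n → ℂ) := ρ.comp (torusConjHom t)
  exact ⟨n, σ, (isIrreducible_iff_of_surjective σ ρ (torusConjHom t) (torusConjHom_surjective t)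
    fun g => rfl).2 hρ, rfl⟩

theorem torusConj_one (t : torus F) (χ : UE F → ℂ) : torusConj t χ 1 = χ 1 := by
  rw [torusConj_eq, Function.comp_apply, map_one]

theorem torusConjHom_x (r : Fin 6 → Fˣ) {a : Lat} (ha : IsPosRoot a) (u : F) :
    torusConjHom ⟨torusHom r⁻¹, r⁻¹, rfl⟩ (x a u) =
      x a (((∏ i, r i ^ (∑ j, a j * CartanMatrix.E₆ j i) : Fˣ) : F) * u) := by
  apply Subtype.ext
  have hx : ∀ u : F, ((x a u : UE F) : GL Wt F) = rootElt F a u := fun u => by rw [x, dif_pos ha]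
  change (torusHom r⁻¹)⁻¹ * ((x a u : UE F) : GL Wt F) * torusHom r⁻¹ = _
  rw [hx, hx, map_inv, inv_inv, torus_conj_rootElt, mul_inv_cancel_right]

theorem exists_cube_root [Finite F] [CharP F 3] (e : Fˣ) : ∃ d : Fˣ, d ^ 3 = e := by
  have : Fact (Nat.Prime 3) := ⟨Nat.prime_three⟩
  have := Fintype.ofFinite F
  obtain ⟨y, hy⟩ := (frobeniusEquiv F 3).surjective (e : F)
  rw [frobeniusEquiv_apply, frobenius_def] at hy
  have hy0 : y ≠ 0 := by
    rintro rfl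
    exact e.ne_zero (by rw [← hy]; simp)
  exact ⟨Units.mk0 y hy0, Units.ext (by simpa using hy)⟩

/-- The witness solves the system of exponents up to a factor 3, with the free fourth coordinate set
to `1`; the factor is absorbed by cube roots, which exist because Frobenius is bijective on `F`. -/
theorem exists_torus_weights [Finite F] [CharP F 3] (e : ℕ → Fˣ) : ∃ r : Fin 6 → Fˣ,
    ∀ k ∈ Finset.Icc 17 21, ∏ i, r i ^ (∑ j, root k j * CartanMatrix.E₆ j i) = e k := by
  choose d hd using fun k => exists_cube_root (e k)
  refine ⟨![d 17 ^ 2 * d 18 ^ 2 * d 20 * d 21, d 17 * d 19 * d 20,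
    d 17 ^ 2 * d 18 * d 19 * d 21 ^ 2, 1, d 18 ^ 2 * d 19 * d 20 ^ 2 * d 21,
    d 17 * d 18 * d 20 ^ 2 * d 21 ^ 2], fun k hk => ?_⟩
  rw [← hd]
  fin_cases hk <;> apply Units.ext <;>
    simp [Fin.prod_univ_six, Fin.sum_univ_six, root, CartanMatrix.E₆] <;> field_simp

theorem ht_root_ne : ∀ i ∈ Finset.Icc 1 16, ht (root i) ≠ 4 := by decide

theorem exists_torusConj_normalized [Finite F] [CharP F 3] {φ : AddChar F ℂ} {χ : UE F → ℂ}
    (hχ : χ ∈ family φ) : ∃ t : torus F, ∀ a, IsPosRoot a → ht a = 4 →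
      ∀ u, torusConj t χ (x a u) = torusConj t χ 1 * φ u := by
  have h : ∀ i, i ∈ Finset.Icc 17 21 → ∃ c : Fˣ, ∀ t, χ (x (root i) t) = χ 1 * φ (c * t) := by
    intro i hi
    obtain ⟨c, hc, h⟩ := hχ.2 (root i)
      (root_isPosRoot i (Finset.Icc_subset_Icc_left (by norm_num) hi)) (ht_root i hi)
    exact ⟨Units.mk0 c hc, h⟩
  choose! c hc using h
  obtain ⟨r, hr⟩ := exists_torus_weights fun i => (c i)⁻¹
  refine ⟨⟨torusHom r⁻¹, r⁻¹, rfl⟩, fun a ha h4 u => ?_⟩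
  obtain ⟨i, hi, rfl⟩ := exists_root_eq 4 a ha h4 le_rfl
  have hi' : i ∈ Finset.Icc 17 21 := by
    simp only [Finset.mem_Icc] at hi ⊢
    refine ⟨?_, hi.2⟩
    by_contra hlt
    exact ht_root_ne i (by simp only [Finset.mem_Icc]; omega) h4
  rw [torusConj_one, torusConj_eq, Function.comp_apply, torusConjHom_x r ha, hr i hi', hc i hi',
    Units.mul_inv_cancel_left]

/-! ### Characters that are trivial on `K₅` -/

/-- A root of height at least 5 is a root `b` of height one less plus a simple root. Its root
elements are commutators with elements of `X_b`, which act as scalars, by hypothesis at height 4 and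
by induction above it. -/
theorem x_eq_one_of_scalar {V : Type*} [AddCommGroup V] [Module ℂ V]
    (ρ : Representation ℂ (UE F) V) (h : ∀ a, IsPosRoot a → ht a = 4 → ∀ t : F,
      ∃ c : ℂ, ∀ v, ρ (x a t) v = c • v) (n : ℕ) :
    ∀ a, IsPosRoot a → ht a = 5 + n → ∀ t : F, ρ (x a t) = 1 := by
  induction n with
  | zero | succ n ih =>
    intro a ha hn t
    obtain ⟨b, i, hb, hip, rfl⟩ := ha.exists_add_simpleRoot (by push_cast at hn; omega)
    rw [ht_add, ht_simpleRoot] at hn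
    obtain ⟨c, hc⟩ : ∃ c : ℂ, ∀ v, ρ (x b ((sgn b (simpleRoot i) : ℤ) * t)) v = c • v := by
      first
      | exact h b hb (by push_cast at hn; omega) _
      | exact ⟨1, fun v => by rw [ih b hb (by push_cast at hn; omega)]; simp⟩
    -- The parameter carries the sign of the structure constant, so that the two signs cancel and
    -- the commutator is exactly the element with parameter `t`.
    have e := x_mul hb (simpleRoot_isPosRoot i) hip ((sgn b (simpleRoot i) : ℤ) * t) (1 : F)
    rw [mul_one, ← mul_assoc ((sgn b (simpleRoot i) : ℤ) : F), ← Int.cast_mul, sgn_mul_self,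
      Int.cast_one, one_mul] at e
    have hcomm : ρ (x b ((sgn b (simpleRoot i) : ℤ) * t) * x (simpleRoot i) 1) =
        ρ (x (simpleRoot i) 1 * x b ((sgn b (simpleRoot i) : ℤ) * t)) := by
      ext1 v
      rw [map_mul, map_mul, Module.End.mul_apply, Module.End.mul_apply, hc, hc, map_smul]
    rw [e, map_mul] at hcomm
    have := congrArg (· * ρ (x (simpleRoot i) 1 * x b ((sgn b (simpleRoot i) : ℤ) * t))⁻¹) hcomm
    simpa only [mul_assoc, ← map_mul, mul_inv_cancel, map_one, mul_one] using this

/-- An irreducible character of `UE₆` that is normalized on the root subgroups of height `4` is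
inflated from `U`, and the root subgroups of height `4` act as scalars. -/
theorem exists_representation_U [Finite F] {φ : AddChar F ℂ} {χ : UE F → ℂ} (hχ : IsIrrChar χ)
    (h4 : ∀ a, IsPosRoot a → ht a = 4 → ∀ u, χ (x a u) = χ 1 * φ u) :
    ∃ (n : ℕ) (ρ : Representation ℂ (U F) (Fin n → ℂ)), ρ.IsIrreducible ∧ χ 1 = n ∧
      χ = inflate ρ.character ∧ ∀ i ∈ Finset.Icc 17 21, ∀ t v, ρ (xU i t) v = φ t • v := by
  obtain ⟨n, ρ, hρ, rfl⟩ := hχ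
  have h1 : ρ.character 1 = n := by simp [Representation.character]
  have hs : ∀ a, IsPosRoot a → ht a = 4 → ∀ t v, ρ (x a t) v = φ t • v := fun a ha hh t v =>
    eq_smul_of_character_eq ρ (x a) (x_add a) φ
      (fun t => by rw [h4 a ha hh, h1, Module.finrank_fin_fun]) t v
  have hK : K5 F ≤ MonoidHom.ker ρ := by
    refine Subgroup.normalClosure_le_normal ?_
    rintro _ ⟨a, ha, hh, t, rfl⟩
    exact x_eq_one_of_scalar ρ (fun a ha hh t => ⟨_, hs a ha hh t⟩) (ht a - 5).toNat a ha
      (by omega) t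
  let σ : Representation ℂ (U F) (Fin n → ℂ) := QuotientGroup.lift (K5 F) ρ hK
  have hσ : ∀ g, ρ g = σ (QuotientGroup.mk g) := fun g => rfl
  exact ⟨n, σ, (isIrreducible_iff_of_surjective ρ σ _ QuotientGroup.mk_surjective hσ).1 hρ, h1,
    rfl, fun i hi t v => hs (root i)
      (root_isPosRoot i (Finset.Icc_subset_Icc_left (by norm_num) hi)) (ht_root i hi) t v⟩

/-! ### Additive characters of `F` -/

theorem exists_mulShift_eq [Finite F] {φ : AddChar F ℂ} (hφ : φ ≠ 1) (ψ : AddChar F ℂ) :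
    ∃ b, ∀ t, ψ t = φ (b * t) := by
  have := Fintype.ofFinite F
  have hinj : Function.Injective φ.mulShift :=
    AddChar.to_mulShift_inj_of_isPrimitive (AddChar.IsPrimitive.of_ne_one hφ)
  have hbij := (Fintype.bijective_iff_injective_and_card φ.mulShift).2 ⟨hinj, AddChar.card_eq.symm⟩
  obtain ⟨b, rfl⟩ := hbij.2 ψ
  exact ⟨b, fun t => AddChar.mulShift_apply⟩

theorem exists_separating [Finite F] {φ : AddChar F ℂ} (hφ : φ ≠ 1) (I : AddSubgroup F) {y : F}
    (hy : y ∉ I) : ∃ e, (∀ z ∈ I, φ (e * z) = 1) ∧ φ (e * y) ≠ 1 := by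
  have hne : (QuotientAddGroup.mk y : F ⧸ I) ≠ 0 := fun h =>
    hy ((QuotientAddGroup.eq_zero_iff y).1 h)
  obtain ⟨ψ, hψ⟩ := AddChar.exists_apply_ne_zero.2 hne
  obtain ⟨e, he⟩ := exists_mulShift_eq hφ (ψ.compAddMonoidHom (QuotientAddGroup.mk' I))
  refine ⟨e, fun z hz => ?_, ?_⟩
  · rw [← he, AddChar.compAddMonoidHom_apply]
    have : QuotientAddGroup.mk' I z = 0 := (QuotientAddGroup.eq_zero_iff z).2 hz
    rw [this, AddChar.map_zero_eq_one]
  · rw [← he]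
    exact hψ

theorem exists_cube_root_field [Finite F] [CharP F 3] (e : F) : ∃ d : F, d ^ 3 = e := by
  by_cases he : e = 0
  · exact ⟨0, by simp [he]⟩
  · obtain ⟨d, hd⟩ := exists_cube_root (Units.mk0 e he)
    exact ⟨d, by rw [← Units.val_pow_eq_pow_val, hd, Units.val_mk0]⟩

/-- The nonzero parameters of the characters that are trivial on all `t³ - c² t` are unique up to
sign. -/
theorem eq_or_eq_neg_of_trivial [Finite F] [CharP F 3] {φ : AddChar F ℂ} (hφ : φ ≠ 1) {c : F}
    (hc : c ≠ 0) {d d' : F} (hd : d ≠ 0) (hd' : d' ≠ 0)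
    (h : ∀ t, φ (d * (t ^ 3 - c ^ 2 * t)) = 1) (h' : ∀ t, φ (d' * (t ^ 3 - c ^ 2 * t)) = 1) :
    d' = d ∨ d' = -d := by
  have : Fact (Nat.Prime 3) := ⟨Nat.prime_three⟩
  -- The character `φ(t³)` has the form `φ(a t)`. For `d = f³` triviality on all `t³ - c² t` then
  -- reads `a f = f³ c²`, that is `(f c)² = a`, which leaves two choices for `f`.
  obtain ⟨a, ha⟩ := exists_mulShift_eq hφ (φ.compAddMonoidHom (frobenius F 3).toAddMonoidHom)
  have ha : ∀ t, φ (t ^ 3) = φ (a * t) := ha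
  have key : ∀ f : F, f ≠ 0 → (∀ t, φ (f ^ 3 * (t ^ 3 - c ^ 2 * t)) = 1) →
      (f * c) ^ 2 = a := by
    intro f hf hh
    have : a * f = f ^ 3 * c ^ 2 := mulShift_injective hφ fun t => by
      rw [mul_assoc, ← ha]
      have e := hh t
      rw [mul_sub, AddChar.map_sub_eq_div, div_eq_one_iff_eq (AddChar.val_isUnit φ _).ne_zero] at e
      rw [mul_pow, e, mul_assoc]
    refine mul_right_cancel₀ hf ?_
    rw [this]; ring
  obtain ⟨f, rfl⟩ := exists_cube_root_field d
  obtain ⟨f', rfl⟩ := exists_cube_root_field d'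
  have e := key f (by rintro rfl; simp at hd) h
  have e' := key f' (by rintro rfl; simp at hd') h'
  rcases sq_eq_sq_iff_eq_or_eq_neg.1 (e'.trans e.symm) with h | h
  · left; rw [mul_right_cancel₀ hc h]
  · right
    rw [← neg_mul] at h
    rw [mul_right_cancel₀ hc h]; ring

theorem IsCPhi.trivial {φ : AddChar F ℂ} {B d : F} (h : IsCPhi φ B d) (t : F) :
    φ (d * (t ^ 3 - B * t)) = 1 := by
  have : d * (t ^ 3 - B * t) ∈ {y : F | φ y = 1} := by
    rw [← h.2]
    exact ⟨t, rfl⟩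
  exact this

theorem exists_isCPhi [Finite F] [CharP F 3] {φ : AddChar F ℂ} (hφ : φ ≠ 1) {c : F}
    (hc : c ≠ 0) : ∃ d, IsCPhi φ (c ^ 2) d := by
  have : Fact (Nat.Prime 3) := ⟨Nat.prime_three⟩
  let P : F →+ F := (frobenius F 3).toAddMonoidHom - AddMonoidHom.mulLeft (c ^ 2)
  have hP : ∀ t, P t = t ^ 3 - c ^ 2 * t := fun t => rfl
  -- On a finite field a surjective map is injective, but `P` vanishes at both `0` and `c`.
  have hns : ¬ Function.Surjective P := fun hs => by
    have hinj := Finite.injective_iff_surjective.2 hs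
    exact hc (hinj (by rw [hP, hP]; ring))
  obtain ⟨y, hy⟩ : ∃ y, y ∉ P.range := by
    by_contra! h
    exact hns fun y => h y
  obtain ⟨d, hd, hdy⟩ := exists_separating hφ P.range hy
  have hd0 : d ≠ 0 := by rintro rfl; simp at hdy
  have hd : ∀ t, φ (d * (t ^ 3 - c ^ 2 * t)) = 1 := fun t => hd _ ⟨t, hP t⟩
  refine ⟨d, hd0, Set.Subset.antisymm ?_ fun z hz => ?_⟩
  · rintro _ ⟨t, rfl⟩
    exact hd t
  · by_contra hz'
    -- If `d · P(F)` were smaller than the kernel of `φ`, a second character `φ(e ·)` would be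
    -- trivial on `P(F)` but not at `z / d`. Uniqueness up to sign gives `e = ±d`, contradicting `φ
    -- z = 1`.
    have hz2 : d⁻¹ * z ∉ P.range := by
      rintro ⟨t, ht⟩
      exact hz' ⟨t, by rw [← hP, ht, mul_inv_cancel_left₀ hd0]⟩
    obtain ⟨e, he, hez⟩ := exists_separating hφ P.range hz2
    have he0 : e ≠ 0 := by rintro rfl; simp at hez
    have hz1 : φ z = 1 := hz
    rcases eq_or_eq_neg_of_trivial hφ hc hd0 he0 hd (fun t => he _ ⟨t, hP t⟩) with rfl | rfl
    · rw [mul_inv_cancel_left₀ hd0] at hez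
      exact hez hz1
    · rw [neg_mul, mul_inv_cancel_left₀ hd0, AddChar.map_neg_eq_inv, hz1, inv_one] at hez
      exact hez rfl

theorem exists_zmod_of_cube_eq_one [CharP F 3] (φ : AddChar F ℂ) {y : F} (hy : φ y ≠ 1) {w : ℂ}
    (hw : w ^ 3 = 1) : ∃ k : ZMod 3, w = φ (k.cast * y) := by
  have h3 : (3 : F) = 0 := by exact_mod_cast CharP.cast_eq_zero F 3
  have hω : φ y ^ 3 = 1 := by
    rw [← AddChar.map_nsmul_eq_pow, nsmul_eq_mul, Nat.cast_ofNat, h3, zero_mul,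
      AddChar.map_zero_eq_one]
  -- So `φ y` is a primitive cube root of unity, and `1`, `φ y`, `φ y ^ 2` are all cube roots of
  -- unity.
  have hs : φ y ^ 2 + φ y + 1 = 0 :=
    mul_left_cancel₀ (sub_ne_zero.2 hy) (by linear_combination hω)
  have : (w - 1) * ((w - φ y) * (w - φ y ^ 2)) = 0 := by
    linear_combination hw - hω - (w ^ 2 - w * φ y) * hs
  rcases mul_eq_zero.1 this with h | h
  · exact ⟨0, by simpa [sub_eq_zero] using h⟩
  · rcases mul_eq_zero.1 h with h | h
    · exact ⟨1, by rw [ZMod.cast_one (dvd_refl 3), one_mul]; exact sub_eq_zero.1 h⟩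
    · refine ⟨2, ?_⟩
      have h2 : ((2 : ZMod 3).cast : F) = 2 := by
        have := ZMod.cast_natCast (R := F) (dvd_refl 3) 2
        exact_mod_cast this
      rw [h2, two_mul, AddChar.map_add_eq_mul, ← sq]
      exact sub_eq_zero.1 h

/-! ### Eigenvectors of `H X₄` -/

section Eigen

variable {V : Type*} [AddCommGroup V] [Module ℂ V] {φ : AddChar F ℂ}
  {ρ : Representation ℂ (U F) V} {b b' : ℕ → F} {v : V}

theorem exists_param [Finite F] (hφ : φ ≠ 1) {K : Subgroup (U F)} (η : K →* ℂˣ) (i : ℕ)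
    (h : ∀ t : F, xU i t ∈ K) : ∃ c, ∀ t, (η ⟨xU i t, h t⟩ : ℂ) = φ (c * t) := by
  let ψ : AddChar F ℂ := {
    toFun := fun t => (η ⟨xU i t, h t⟩ : ℂ)
    map_zero_eq_one' := by
      have : (⟨xU i (0 : F), h 0⟩ : K) = 1 := Subtype.ext (xU_zero i)
      simp [this]
    map_add_eq_mul' := fun s t => by
      have : (⟨xU i (s + t), h _⟩ : K) = ⟨xU i s, h s⟩ * ⟨xU i t, h t⟩ := Subtype.ext (xU_add i s t)
      exact (congrArg (fun k => (η k : ℂ)) this).trans (by simp only [map_mul, Units.val_mul]) }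
  exact exists_mulShift_eq hφ ψ

theorem hasChar_of_closure {G : Type*} [Group G] {ρ : Representation ℂ G V} (hv : v ≠ 0)
    (S : Set G) (η : Subgroup.closure S →* ℂˣ)
    (h : ∀ g (hg : g ∈ S), ρ g v = (η ⟨g, Subgroup.subset_closure hg⟩ : ℂ) • v) :
    HasChar ρ (Subgroup.closure S) η v := by
  refine ⟨hv, ?_⟩
  rintro ⟨g, hg⟩
  induction hg using Subgroup.closure_induction with
  | mem g hg => exact h g hg
  | one =>
    have : (⟨1, one_mem _⟩ : Subgroup.closure S) = 1 := rfl
    rw [this, map_one]; simp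
  | mul x y hx hy ihx ihy =>
    have : (⟨x * y, mul_mem hx hy⟩ : Subgroup.closure S) = ⟨x, hx⟩ * ⟨y, hy⟩ := rfl
    simp only at ihx ihy ⊢
    rw [this, map_mul, map_mul, Module.End.mul_apply, ihy, map_smul, ihx, smul_smul, Units.val_mul,
      mul_comm]
  | inv x hx ih =>
    have : (⟨x⁻¹, inv_mem hx⟩ : Subgroup.closure S) = ⟨x, hx⟩⁻¹ := rfl
    simp only at ih ⊢
    have e : ρ x⁻¹ (ρ x v) = v := by
      rw [← Module.End.mul_apply, ← map_mul, inv_mul_cancel, map_one, Module.End.one_apply]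
    rw [ih, map_smul] at e
    rw [this, map_inv η, Units.val_inv_eq_inv_val, eq_inv_smul_iff₀ (Units.ne_zero _)]
    exact e

theorem IsEig.hasChar (h : IsEig φ ρ b v) (η : HX4 F →* ℂˣ)
    (hη : ∀ i (hi : i ∈ insert 4 indexH) t, (η ⟨xU i t, xU_mem_HX4 hi t⟩ : ℂ) = φ (b i * t)) :
    HasChar ρ (HX4 F) η v := by
  refine hasChar_of_closure h.1 _ η ?_
  rintro _ ⟨i, hi, t, rfl⟩
  have hi' : i ∈ insert 4 indexH := by rwa [Finset.mem_insert, or_comm]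
  rw [h.2 i hi', ← hη i hi']
  rfl

theorem IsEig.HX4_le (h : IsEig φ ρ b v) : HX4 F ≤ lineStab ρ v := by
  rw [HX4_eq_gen]
  exact gen_le fun i hi t => ⟨_, (AddChar.val_isUnit φ _).ne_zero, h.2 i hi t⟩

theorem HasChar.apply_eq {G : Type*} [Group G] {ρ : Representation ℂ G V} {K : Subgroup G}
    {η : K →* ℂˣ} (h : HasChar ρ K η v) {g : G} (hg : g ∈ K) {c : ℂ} (hc : ρ g v = c • v) :
    (η ⟨g, hg⟩ : ℂ) = c :=
  smul_left_injective_of_ne_zero h.1 ((h.2 ⟨g, hg⟩).symm.trans hc)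

theorem mem_insert_of_mem_indexH {i : ℕ} (hi : i ∈ indexH) : i ∈ insert 4 indexH :=
  Finset.mem_insert_of_mem hi

theorem IsEig.extends {K : Subgroup (U F)} {η : K →* ℂˣ} (h : IsEig φ ρ b v)
    (hb : IsNormalized b) (hη : HasChar ρ K η v)
    (hbb : ∀ i ∈ indexH, i < 17 → b' i = b i) : Extends φ b' K η := by
  intro i hi t hm
  rw [hη.apply_eq hm (h.2 i (mem_insert_of_mem_indexH hi) t)]
  split_ifs with h17
  · rw [hb i (Finset.mem_Icc.2 ⟨h17, ((by decide : ∀ i ∈ indexH, i ≤ 21) i hi)⟩)]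
  · rw [hbb i hi (not_le.1 h17)]

/-- An eigenvector of `H X₄` exists if the root subgroups of height `4` act as `φ`. -/
theorem exists_isEig [Finite F] [FiniteDimensional ℂ V] [Nontrivial V] (hφ : φ ≠ 1)
    (h : ∀ i ∈ Finset.Icc 17 21, ∀ t v, ρ (xU i t) v = φ t • v) :
    ∃ b v, IsNormalized b ∧ IsEig φ ρ b v := by
  obtain ⟨v, -, hv, hc⟩ := exists_common_eigenvector
    (fun i : {i // i ∈ insert 4 indexH} × F => ρ (xU i.1 i.2))
    (fun i j => by
      rw [Commute, SemiconjBy, ← map_mul, ← map_mul, xU_commute (indexA_subset i.1.2)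
        (indexA_subset j.1.2) (comm_indexA _ i.1.2 _ j.1.2)]) ⊤ top_ne_bot (fun _ _ _ => trivial)
  have hle : HX4 F ≤ lineStab ρ v := by
    rw [HX4_eq_gen]
    refine gen_le fun i hi t => ?_
    obtain ⟨c, hc⟩ := hc (⟨i, hi⟩, t)
    refine ⟨c, ?_, hc⟩
    rintro rfl
    exact rho_ne_zero ρ _ hv (hc.trans (zero_smul _ _))
  obtain ⟨η, hη⟩ := exists_hasChar ρ hv _ hle
  have hp : ∀ i, i ∈ insert 4 indexH → ∃ c, ∀ t v', v' = v → ρ (xU i t) v' = φ (c * t) • v' := by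
    intro i hi
    obtain ⟨c, hc⟩ := exists_param hφ η i (xU_mem_HX4 hi)
    refine ⟨c, fun t v' hv' => ?_⟩
    rw [hv', ← hc]
    exact hη.2 ⟨xU i t, xU_mem_HX4 hi t⟩
  choose! b hb using hp
  refine ⟨b, v, fun i hi => ?_, hv, fun i hi t => hb i hi t v rfl⟩
  have hi' : i ∈ insert 4 indexH := (by decide : Finset.Icc 17 21 ⊆ insert 4 indexH) hi
  refine mulShift_injective hφ fun t => ?_
  rw [one_mul]
  exact smul_left_injective_of_ne_zero hv ((hb i hi' t v rfl).symm.trans (h i hi t v))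

/-! ### Moving eigenvectors inside an orbit -/

theorem exists_isEig_trivialOnH3 (hv : IsEig φ ρ b v) (hb : IsNormalized b) (h : B3 b = 0) :
    ∃ b' v', IsNormalized b' ∧ TrivialOnH3 b' ∧ IsEig φ ρ b' v' := by
  obtain ⟨p, hp⟩ := exists_moveSimple (b' := 0) hb (by rw [h]; simp [B3])
  exact ⟨_, _, moveSimple_normalized hb p, hp, hv.moveSimple p⟩

/-- All characters of `H X₄` with the same `B₃ ≠ 0` are conjugate, up to the value on `X₄`. -/
theorem exists_isEig_of_B3 [CharP F 3] (hv : IsEig φ ρ b v) (hb : IsNormalized b)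
    (h : B3 b ≠ 0) (hB : B3 b = B3 b') :
    ∃ b'' v', IsNormalized b'' ∧ (∀ i ∈ Finset.Icc 8 10 ∪ Finset.Icc 12 16, b'' i = b' i) ∧
      IsEig φ ρ b'' v' := by
  obtain ⟨p, hp⟩ := exists_moveSimple hb hB
  have hB' : B3 (moveSimple p b) ≠ 0 := by
    have e : B3 (moveSimple p b) = B3 b' := by
      simp only [B3]
      rw [hp 12 (by decide), hp 13 (by decide), hp 14 (by decide), hp 15 (by decide),
        hp 16 (by decide)]
    rwa [e, ← hB]
  obtain ⟨t, r, s, h⟩ := exists_moveS1 (moveSimple_normalized hb p) hp hB'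
  exact ⟨_, _, moveS1_normalized (moveSimple_normalized hb p) t r s, h,
    (hv.moveSimple p).moveS1 t r s⟩

theorem commute_s1_zero_s2 (r s c : F) : Commute (s1 0 r s) (s2 c) := by
  have e : s1 0 r s = xU 7 r * xU 11 s := by simp [s1, xU_zero]
  rw [e]
  exact (commute_s1 _ _ _ fun i hi u => commute_xU7 i hi r u).mul_left
    (commute_s1 _ _ _ fun i hi u => commute_xU11 i hi s u)

/-- Characters of `H X₄` that are trivial on `H₃`, have the same `B₂`, and whose values on `X₄`
differ by an element of the form `t³ - B₂ t`, are conjugate by an element that commutes with all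
`s₂(c)`. -/
theorem exists_isEig_of_B2 [CharP F 3] (hv : IsEig φ ρ b v) (hb : IsNormalized b)
    (hb' : IsNormalized b') (h : TrivialOnH3 b) (h' : TrivialOnH3 b') (hB : B2 b = B2 b')
    (h4 : ∃ t, b' 4 - b 4 = t ^ 3 - B2 b * t) :
    ∃ g, (∀ c, Commute g (s2 c)) ∧ IsEig φ ρ b' (ρ g v) := by
  obtain ⟨t, ht⟩ := h4
  -- An element of `X₇ X₁₁` first matches the parameters on `H` without changing `b₄`; then `s₂(-t)`
  -- adds `t³ - B₂ t` to `b₄` and leaves the rest fixed. Both factors commute with every `s₂(c)`.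
  obtain ⟨r, s, hrs, hrs4⟩ := exists_moveS1_zero hb h h' hB
  have hb1 := moveS1_normalized hb 0 r s
  have ht1 : TrivialOnH3 (moveS1 0 r s b) := fun i hi => by
    rw [hrs i (Finset.mem_union_right _ hi), h' i hi]
  have hB1 : B2 (moveS1 0 r s b) = B2 b := by
    rw [hB]
    simp only [B2]
    rw [hrs 8 (by decide), hrs 9 (by decide), hrs 10 (by decide)]
  obtain ⟨e, e4⟩ := moveS2_apply hb1 ht1 (-t)
  refine ⟨s2 (-t) * s1 0 r s, fun c => ?_, ?_⟩
  · refine Commute.mul_left ?_ (commute_s1_zero_s2 r s c)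
    rw [Commute, SemiconjBy, ← s2_add, ← s2_add, add_comm]
  · rw [map_mul, Module.End.mul_apply]
    refine ((hv.moveS1 0 r s).moveS1 (-t) (2 * (-t) ^ 2) (2 * (-t) ^ 2)).congr fun i hi => ?_
    rcases Finset.mem_insert.1 hi with rfl | hi
    · rw [e4, hB1, hrs4]; linear_combination ht
    · rw [e i hi]
      rcases (by decide : ∀ i ∈ indexH, i ∈ Finset.Icc 8 10 ∪ Finset.Icc 12 16 ∨
        i ∈ Finset.Icc 17 21) i hi with hi | hi
      · exact (hrs i hi).symm
      · rw [hb' i hi, hb1 i hi]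

/-- If `B₂ = c²` is a nonzero square, then there is a common eigenvector of `H X₄ F₂`. -/
theorem exists_eigenvector_HX4F2 [CharP F 3] [FiniteDimensional ℂ V] (hv : IsEig φ ρ b v)
    (hb : IsNormalized b) (h : TrivialOnH3 b) {c : F} (hB : B2 b = c ^ 2) :
    ∃ v', IsEig φ ρ b v' ∧ HX4F2 (c ^ 2) ≤ lineStab ρ v' := by
  -- The eigenspace of `HX4` for `b`. It is stable under `s₂(c)` because `c³ - c² c = 0`, so `s₂(c)`
  -- has an eigenvector in it.
  let W : Submodule ℂ V :=
    { carrier := {w | ∀ i ∈ insert 4 indexH, ∀ t, ρ (xU i t) w = φ (b i * t) • w}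
      zero_mem' := fun i _ t => by simp
      add_mem' := fun hx hy i hi t => by rw [map_add, hx i hi, hy i hi, smul_add]
      smul_mem' := fun a x hx i hi t => by rw [map_smul, hx i hi, smul_comm] }
  have hW : W ≠ ⊥ := (Submodule.ne_bot_iff _).2 ⟨v, hv.2, hv.1⟩
  have hst : ∀ w ∈ W, ρ (s2 c) w ∈ W := by
    intro w hw
    by_cases h0 : w = 0
    · rw [h0, map_zero]; exact zero_mem _
    obtain ⟨e, e4⟩ := moveS2_apply hb h c
    have hw' : IsEig φ ρ b w := ⟨h0, hw⟩
    refine ((hw'.moveS1 c (2 * c ^ 2) (2 * c ^ 2)).congr (b' := b) fun i hi => ?_).2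
    rcases Finset.mem_insert.1 hi with rfl | hi
    · rw [e4, hB]; ring
    · exact (e i hi).symm
  obtain ⟨v', hv', h0, hc⟩ := exists_common_eigenvector (fun _ : Unit => ρ (s2 c))
    (fun _ _ => Commute.refl _) W hW (fun _ => hst)
  have hE : IsEig φ ρ b v' := ⟨h0, hv'⟩
  refine ⟨v', hE, sup_le hE.HX4_le ?_⟩
  obtain ⟨a, ha⟩ := hc ()
  have hmem : s2 c ∈ lineStab ρ v' := by
    refine ⟨a, ?_, ha⟩
    rintro rfl
    exact rho_ne_zero ρ _ h0 (ha.trans (zero_smul _ _))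
  rw [Subgroup.closure_le]
  rintro _ ⟨d, hd, rfl⟩
  rcases sq_eq_sq_iff_eq_or_eq_neg.1 hd with rfl | rfl
  · exact hmem
  · rw [s2_neg]; exact inv_mem hmem

end Eigen

/-! ### Identification of the character in the three cases -/

section Eigen

variable {V : Type*} [AddCommGroup V] [Module ℂ V] {φ : AddChar F ℂ}
  {ρ : Representation ℂ (U F) V} {b : ℕ → F} {v : V}

theorem nontrivial_of_isIrreducible (hρ : ρ.IsIrreducible) : Nontrivial V := by
  by_contra h
  rw [not_nontrivial_iff_subsingleton] at h
  obtain ⟨W, W', hne⟩ := hρ.toNontrivial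
  exact hne (Subrepresentation.toSubmodule_injective (Subsingleton.elim _ _))

/-- The parameters of a linear character `η` of a group containing `H X₄`. -/
theorem exists_param_of_extends [Finite F] (hφ : φ ≠ 1) {K : Subgroup (U F)}
    (hK : HX4 F ≤ K) {η : K →* ℂˣ} (hη : Extends φ b K η) :
    ∃ b' : ℕ → F, IsNormalized b' ∧ (∀ i ∈ indexH, i < 17 → b' i = b i) ∧
      ∀ i (hi : i ∈ insert 4 indexH) t,
        (η ⟨xU i t, hK (xU_mem_HX4 hi t)⟩ : ℂ) = φ (b' i * t) := by
  obtain ⟨c, hc⟩ := exists_param hφ η 4 fun t => hK (xU_mem_HX4 (Finset.mem_insert_self _ _) t)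
  refine ⟨fun i => if i = 4 then c else if 17 ≤ i then 1 else b i, fun i hi => ?_,
    fun i hi h17 => ?_, fun i hi t => ?_⟩
  · have h := (Finset.mem_Icc.1 hi).1
    beta_reduce
    rw [if_neg (by omega), if_pos h]
  · beta_reduce
    rw [if_neg (by rintro rfl; exact absurd hi (by decide)), if_neg (by omega)]
  · beta_reduce
    rcases Finset.mem_insert.1 hi with rfl | hi'
    · rw [if_pos rfl, hc]
    · rw [if_neg (by rintro rfl; exact absurd hi' (by decide))]
      exact hη i hi' t _

theorem trivialOnH3_congr {b b' : ℕ → F} (h : ∀ i ∈ indexH, i < 17 → b' i = b i)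
    (hb : TrivialOnH3 b) : TrivialOnH3 b' := fun i hi => by
  rw [h i ((by decide : Finset.Icc 12 16 ⊆ indexH) hi) (by
    have := (Finset.mem_Icc.1 hi).2; omega), hb i hi]

theorem B2_congr {b b' : ℕ → F} (h : ∀ i ∈ indexH, i < 17 → b' i = b i) : B2 b' = B2 b := by
  simp only [B2]
  rw [h 8 (by decide) (by norm_num), h 9 (by decide) (by norm_num), h 10 (by decide) (by norm_num)]

/-- The case `B₃ ≠ 0`. -/
theorem character_eq_of_B3 [Finite F] [CharP F 3] (hρ : ρ.IsIrreducible)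
    (hd : Nat.card F ^ 7 ≤ Module.finrank ℂ V) (hv : IsEig φ ρ b v) (hb : IsNormalized b)
    (h : B3 b ≠ 0) {b' : ℕ → F} (hB : B3 b = B3 b') :
    ∃ b₄ : F, ∃ η : HX4 F →* ℂˣ, Extends φ b' (HX4 F) η ∧
      (∀ (t : F) (h : xU 4 t ∈ HX4 F), (η ⟨xU 4 t, h⟩ : ℂ) = φ (b₄ * t)) ∧
      ρ.character = ind (HX4 F) η := by
  obtain ⟨c, w, hc, hcb, hw⟩ := exists_isEig_of_B3 hv hb h hB
  obtain ⟨η, hη⟩ := exists_hasChar ρ hw.1 _ hw.HX4_le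
  refine ⟨c 4, η, hw.extends hc hη fun i hi h17 => (hcb i ?_).symm,
    fun t h => hη.apply_eq h (hw.2 4 (Finset.mem_insert_self _ _) t),
    character_eq_ind ρ hη (index_HX4_le.trans hd)⟩
  exact (by decide : ∀ i ∈ indexH, i < 17 → i ∈ Finset.Icc 8 10 ∪ Finset.Icc 12 16) i hi h17

/-- The case `B₃ = 0` and `B₂` not a nonzero square. -/
theorem character_eq_of_B2 [Finite F] [CharP F 3] (hφ : φ ≠ 1) (hρ : ρ.IsIrreducible)
    (hd : Nat.card F ^ 7 ≤ Module.finrank ℂ V) (hv : IsEig φ ρ b v) (hb : IsNormalized b)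
    (h : TrivialOnH3 b) (hB : ¬ IsNonzeroSquare (B2 b)) :
    (extB2 φ (B2 b)).Nonempty ∧ ∀ η ∈ extB2 φ (B2 b), ρ.character = ind (HX4 F) η := by
  constructor
  · obtain ⟨η, hη⟩ := exists_hasChar ρ hv.1 _ hv.HX4_le
    exact ⟨η, b, h, rfl, hv.extends hb hη fun _ _ _ => rfl⟩
  · rintro η ⟨b', h', hB', hη⟩
    obtain ⟨c, hc, hcb, hcη⟩ := exists_param_of_extends hφ le_rfl hη
    have hinj : Function.Injective fun t : F => t ^ 3 - B2 b * t := fun t t' =>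
      eq_of_cube_sub_eq hB
    -- Injectivity on the finite field gives surjectivity, so any two values of `b₄` are conjugate.
    -- This is why the character does not depend on the extension to `X₄`.
    obtain ⟨t, ht⟩ := Finite.surjective_of_injective hinj (c 4 - b 4)
    obtain ⟨g, -, hg⟩ := exists_isEig_of_B2 hv hb hc h (trivialOnH3_congr hcb h')
      (by rw [B2_congr hcb, hB']) ⟨t, ht.symm⟩
    exact character_eq_ind ρ (hg.hasChar η hcη) (index_HX4_le.trans hd)

theorem HX4F2_eq_closure (B : F) : HX4F2 B = Subgroup.closure
    ({u | ∃ i, (i ∈ indexH ∨ i = 4) ∧ ∃ t, u = xU i t} ∪ {u | ∃ c : F, c ^ 2 = B ∧ u = s2 c}) :=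
  (Subgroup.closure_union _ _).symm

theorem HX4_le_HX4F2 (B : F) : HX4 F ≤ HX4F2 B := le_sup_left

theorem s2_mem_HX4F2 {B c : F} (h : c ^ 2 = B) : s2 c ∈ HX4F2 B :=
  (le_sup_right : _ ≤ HX4F2 B) (Subgroup.subset_closure ⟨c, h, rfl⟩)

theorem IsEig.hasChar_HX4F2 (h : IsEig φ ρ b v) {B : F} (η : HX4F2 B →* ℂˣ)
    (hη : ∀ i (hi : i ∈ insert 4 indexH) t,
      (η ⟨xU i t, HX4_le_HX4F2 B (xU_mem_HX4 hi t)⟩ : ℂ) = φ (b i * t))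
    (hs : ∀ c (hc : c ^ 2 = B), ρ (s2 c) v = (η ⟨s2 c, s2_mem_HX4F2 hc⟩ : ℂ) • v) :
    HasChar ρ (HX4F2 B) η v := by
  -- Transport along the equality of subgroups, since the criterion for eigenvectors is stated for a
  -- literal closure.
  have key : ∀ (K : Subgroup (U F)) (hK : K = HX4F2 B) (η' : K →* ℂˣ),
      (∀ g (hg : g ∈ K), η' ⟨g, hg⟩ = η ⟨g, hK ▸ hg⟩) → HasChar ρ K η' v →
        HasChar ρ (HX4F2 B) η v := by
    rintro K rfl η' he h'
    exact ⟨h'.1, fun k => by rw [h'.2 k, ← he k.1 k.2]⟩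
  refine key _ (HX4F2_eq_closure B).symm
    (η.comp (Subgroup.inclusion (HX4F2_eq_closure B).ge)) (fun _ _ => rfl) ?_
  refine hasChar_of_closure h.1 _ _ ?_
  rintro _ (⟨i, hi, t, rfl⟩ | ⟨c, hc, rfl⟩)
  · have hi' : i ∈ insert 4 indexH := by rwa [Finset.mem_insert, or_comm]
    rw [h.2 i hi', ← hη i hi']
    rfl
  · exact hs c hc

theorem cube_eq_one_of_add_self [CharP F 3] {G : Type*} [Group G] (f : F → G)
    (hf : ∀ s t, f (s + t) = f s * f t) (t : F) : f t ^ 3 = 1 := by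
  have h3 : (3 : F) = 0 := by exact_mod_cast CharP.cast_eq_zero F 3
  have h0 : f 0 = 1 := by
    have := hf 0 0
    rw [add_zero] at this
    exact left_eq_mul.1 this
  rw [pow_succ, sq, ← hf, ← hf, ← h0]
  congr 1
  linear_combination t * h3

/-- The case `B₃ = 0` and `B₂ = c²` a nonzero square. -/
theorem character_eq_of_square [Finite F] [CharP F 3] [FiniteDimensional ℂ V] (hφ : φ ≠ 1)
    (hρ : ρ.IsIrreducible)
    (hd : Nat.card F ^ 7 ≤ 3 * Module.finrank ℂ V) (hv : IsEig φ ρ b v) (hb : IsNormalized b)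
    (h : TrivialOnH3 b) {c : F} (hc : c ≠ 0) (hB : B2 b = c ^ 2) {a₂ a₄ : F}
    (ha₂ : φ (a₂ * c) ≠ 1) (ha₄ : ∀ d, IsCPhi φ (c ^ 2) d → φ (a₄ * d) ≠ 1) :
    ∃ b₂ b₄ : ZMod 3, (extF2 φ (c ^ 2) (b₂.cast * a₂) (b₄.cast * a₄)).Nonempty ∧
      ∀ η ∈ extF2 φ (c ^ 2) (b₂.cast * a₂) (b₄.cast * a₄),
        ρ.character = ind (HX4F2 (c ^ 2)) η := by
  obtain ⟨w, hw, hwK⟩ := exists_eigenvector_HX4F2 hv hb h hB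
  obtain ⟨θ, hθ⟩ := exists_hasChar ρ hw.1 _ hwK
  obtain ⟨d, hd'⟩ := exists_isCPhi hφ hc
  -- The labels `b₂` and `b₄` are read off from the eigenvalues at `s₂(c)` and `x₄(d)`, both cube
  -- roots of unity.
  have hθs : (θ ⟨s2 c, s2_mem_HX4F2 rfl⟩ : ℂ) ^ 3 = 1 := by
    rw [← Units.val_pow_eq_pow_val, ← map_pow, ← Units.val_one, ← map_one θ]
    congr 2
    exact Subtype.ext (cube_eq_one_of_add_self s2 s2_add c)
  obtain ⟨b₂, hb₂⟩ := exists_zmod_of_cube_eq_one φ ha₂ hθs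
  have hφd : φ (b 4 * d) ^ 3 = 1 := by
    rw [← AddChar.map_nsmul_eq_pow, nsmul_eq_mul, CharP.cast_eq_zero F 3, zero_mul,
      AddChar.map_zero_eq_one]
  obtain ⟨b₄, hb₄⟩ := exists_zmod_of_cube_eq_one φ (ha₄ d hd') hφd
  rw [← mul_assoc] at hb₂ hb₄
  have hs : ∀ c', c' ^ 2 = c ^ 2 → ρ (s2 c') w = φ (b₂.cast * a₂ * c') • w := by
    have h1 : ρ (s2 c) w = φ (b₂.cast * a₂ * c) • w := by
      rw [← hb₂]
      exact hθ.2 ⟨s2 c, s2_mem_HX4F2 rfl⟩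
    intro c' hc'
    rcases sq_eq_sq_iff_eq_or_eq_neg.1 hc' with rfl | rfl
    · exact h1
    · have e : ρ (s2 (-c)) (ρ (s2 c) w) = w := by
        rw [← Module.End.mul_apply, ← map_mul, ← s2_add, neg_add_cancel, s2_zero, map_one,
          Module.End.one_apply]
      rw [h1, map_smul] at e
      nth_rw 2 [← e]
      rw [smul_smul, ← AddChar.map_add_eq_mul, mul_neg, neg_add_cancel, AddChar.map_zero_eq_one,
        one_smul]
  refine ⟨b₂, b₄, ⟨θ, ⟨b, h, hB, hw.extends hb hθ fun _ _ _ => rfl⟩,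
    fun c' hm hc' => hθ.apply_eq hm (hs c' hc'), fun d' hm hcd => ?_⟩, ?_⟩
  · rw [hθ.apply_eq hm (hw.2 4 (Finset.mem_insert_self _ _) d')]
    rcases eq_or_eq_neg_of_trivial hφ hc hd'.1 hcd.1 hd'.trivial hcd.trivial with rfl | rfl
    · exact hb₄
    · rw [mul_neg, mul_neg, AddChar.map_neg_eq_inv, AddChar.map_neg_eq_inv, hb₄]
  · rintro η ⟨⟨b', h', hB', hη⟩, hη₂, hη₄⟩
    obtain ⟨e, he, heb, heη⟩ := exists_param_of_extends hφ (HX4_le_HX4F2 _) hη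
    -- Both characters agree at `x₄(d)`; as the kernel of `φ` is `d · {t³ - c² t}`, the two
    -- parameters on `X₄` differ by some `t³ - c² t`.
    have h4 : (e 4 - b 4) * d ∈ {y : F | φ y = 1} := by
      have h1 := heη 4 (Finset.mem_insert_self _ _) d
      rw [hη₄ d _ hd', ← hb₄] at h1
      change φ _ = 1
      rw [sub_mul, AddChar.map_sub_eq_div, ← h1, div_self (AddChar.val_isUnit φ _).ne_zero]
    rw [← hd'.2] at h4
    obtain ⟨t, ht⟩ := h4
    obtain ⟨g, hgs, hg⟩ := exists_isEig_of_B2 hw hb he h (trivialOnH3_congr heb h')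
      (by rw [B2_congr heb, hB', hB])
      ⟨t, mul_right_cancel₀ hd'.1 (by rw [ht, hB]; ring)⟩
    refine character_eq_ind ρ (hg.hasChar_HX4F2 η heη fun c' hc' => ?_) ?_
    · rw [hη₂ c' _ hc', ← Module.End.mul_apply, ← map_mul, ← (hgs c').eq, map_mul,
        Module.End.mul_apply, hs c' hc', map_smul]
    · have := three_mul_index_HX4F2_le hc
      omega

/-- If `B₃ = 0` and `B₂` is a nonzero square, then the dimension is at most `q⁷ / 3`. -/
theorem three_mul_finrank_le [Finite F] [CharP F 3] [FiniteDimensional ℂ V] (hρ : ρ.IsIrreducible)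
    (hv : IsEig φ ρ b v) (hb : IsNormalized b)
    (h : TrivialOnH3 b) {c : F} (hc : c ≠ 0) (hB : B2 b = c ^ 2) :
    3 * Module.finrank ℂ V ≤ Nat.card F ^ 7 := by
  obtain ⟨w, hw, hwK⟩ := exists_eigenvector_HX4F2 hv hb h hB
  obtain ⟨θ, hθ⟩ := exists_hasChar ρ hw.1 _ hwK
  exact (Nat.mul_le_mul_left 3 (finrank_le_index ρ hθ)).trans (three_mul_index_HX4F2_le hc)

end Eigen

end E6Sylow

/-! ### Proof of the theorem: the degree decides the case -/

open E6Sylow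

theorem theorem3p3 {F : Type*} [Field F] [Fintype F] [CharP F 3]
    (φ : AddChar F ℂ) (hφ : φ ≠ 1) (L : Labelling φ)
    (χ : UE F → ℂ) (hχ : χ ∈ family φ) :
    (χ 1 = (Fintype.card F : ℂ) ^ 7 →
      ∃ t : torus F,
        (∃ b₄ B₃ : F, B₃ ≠ 0 ∧ IsChiB3 φ (L.rep B₃) b₄ (torusConj t χ)) ∨
        (∃ B₂ : F, ¬ IsNonzeroSquare B₂ ∧ IsChiB2 φ B₂ (torusConj t χ))) ∧
    (χ 1 = (Fintype.card F : ℂ) ^ 7 / 3 →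
      ∃ t : torus F, ∃ (b₂ b₄ : ZMod 3) (B₂ : F), IsNonzeroSquare B₂ ∧
        IsChiThird φ (L.a₂ B₂) (L.a₄ B₂) b₂ b₄ B₂ (torusConj t χ)) := by
  obtain ⟨t, ht⟩ := exists_torusConj_normalized hχ
  obtain ⟨n, ρ, hρ, h1, hχρ, hs⟩ := exists_representation_U (isIrrChar_torusConj t hχ.1) ht
  rw [torusConj_one] at h1
  have := nontrivial_of_isIrreducible hρ
  obtain ⟨b, v, hb, hv⟩ := exists_isEig hφ hs
  have hn : Module.finrank ℂ (Fin n → ℂ) = n := Module.finrank_fin_fun ℂ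
  have hpos : 0 < Nat.card F ^ 7 := pow_pos Nat.card_pos 7
  constructor
  · intro hdeg
    have hd : n = Nat.card F ^ 7 := by
      rw [Nat.card_eq_fintype_card]
      exact_mod_cast h1.symm.trans hdeg
    have hle : Nat.card F ^ 7 ≤ Module.finrank ℂ (Fin n → ℂ) := by rw [hn, hd]
    refine ⟨t, ?_⟩
    by_cases h3 : B3 b = 0
    · right
      obtain ⟨b, v, hb, h0, hv⟩ := exists_isEig_trivialOnH3 hv hb h3
      -- For a nonzero square the larger stabilizer would bound the degree by `q⁷/3`.
      have hB : ¬ IsNonzeroSquare (B2 b) := by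
        rintro ⟨c, hc, hB⟩
        have := three_mul_finrank_le hρ hv hb h0 hc hB
        omega
      obtain ⟨hne, hall⟩ := character_eq_of_B2 hφ hρ hle hv hb h0 hB
      exact ⟨B2 b, hB, hne, fun η hη => by rw [hχρ, hall η hη]⟩
    · left
      obtain ⟨b₄, η, h1, h2, h3'⟩ := character_eq_of_B3 hρ hle hv hb h3 (L.B3_rep _ h3).symm
      exact ⟨b₄, B3 b, h3, η, h1, h2, by rw [hχρ, h3']⟩
  · intro hdeg
    have hd : 3 * n = Nat.card F ^ 7 := by
      rw [Nat.card_eq_fintype_card]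
      have : (3 : ℂ) * n = (Fintype.card F : ℂ) ^ 7 := by rw [← h1, hdeg]; ring
      exact_mod_cast this
    -- The degree is smaller than `q⁷`, which rules out both kinds of regular orbits: first `B₃ ≠
    -- 0`, then `B₂` not a nonzero square.
    have h3 : B3 b = 0 := by
      by_contra h3
      have := pow_seven_le_finrank hφ hv hb (moveS1_injective_of_B3 hb h3)
      omega
    obtain ⟨b, v, hb, h0, hv⟩ := exists_isEig_trivialOnH3 hv hb h3
    have hB : IsNonzeroSquare (B2 b) := by
      by_contra hB
      have := pow_seven_le_finrank hφ hv hb (moveS1_injective_of_B2 hb h0 hB)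
      omega
    obtain ⟨c, hc, hB⟩ := hB
    obtain ⟨b₂, b₄, hne, hall⟩ := character_eq_of_square hφ hρ (by rw [hn, hd]) hv hb h0 hc hB
      (L.a₂_spec c hc) (fun d hd => L.a₄_spec c d hc hd)
    exact ⟨t, b₂, b₄, c ^ 2, ⟨c, hc, rfl⟩, hne, fun η hη => by rw [hχρ, hall η hη]⟩
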